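/- Let $F$ be a free group (of any rank), and let $H$ and $K$ be nontrivial finitely generated subgroups of $F$, of ranks $h$ and $k$ respectively, where the rank of a finitely generated free group is its minimal number of generators (equivalently, the cardinality of a free basis). For $g\in F$ write $K^g=gKg^{-1}$. Then: (1) $H\cap K$ is finitely generated and \[ \mathrm{rank}(H\cap K)-1\ \le\ 2(h-1)(k-1)-\min\{h-1,\,k-1\}. \] (2) For every $g\in F$ the group $H\cap K^g$ is finitely generated. Moreover, if $X\subseteq F$ is any set of representatives for the double cosets $H\backslash F/K$ (one element from each $HgK$), then the set $Y=\{g\in X : H\cap K^g\neq 1\}$ is finite and \[ \sum_{g\in Y}\bigl(\mathrm{rank}(H\cap K^g)-1\bigr)\ \le\ 2(h-1)(k-1)-\min\{h-1,\,k-1\}. \] -/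

import Mathlib

open scoped Pointwise

/-! The stronger bound (h-1)(k-1) is proved, by counting bridges in ordered trees. A free group is
left-orderable, so it acts freely on its Cayley tree preserving a linear order of the edges. Call an
edge a bridge if both its ends lie in infinite components of the graph of smaller edges.

Let a nontrivial group L act in this way on a tree with finitely many orbits. Sending each vertex to
the first edge on the way to where its component becomes infinite is an equivariant bijection onto
the edges that are not bridges (`exists_equivariant`). So the number of bridge orbits is the number
of edge orbits minus the number of vertex orbits. By the Euler characteristic formula this is dim
Hom(L, ℚ) - 1, which is rank L - 1 for free L.

Choose invariant subtrees A for H and B for K with finitely many orbits. If H ∩ gKg⁻¹ is nontrivial,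
then A ∩ gB is a nonempty invariant subtree for it. Enlarging a tree only enlarges components, so a
bridge of A ∩ gB is a bridge of A, and its translate by g⁻¹ is a bridge of B (`IsBridge.map`).
Freeness makes the resulting map from bridge orbits, over all double cosets together, to pairs of
bridge orbits injective (`injective_orbitPair`). Counting gives the sum bound. Finally ab ≤ 2ab -
min(a, b) for integers a, b ≥ 0. -/

namespace OrderedTree

open Set

variable {V E V' E' : Type*} {s t : E → V} {s' t' : E' → V'} {P Q : Set E} {x y z : V} {e : E}

/-! ### Paths and components in oriented graphs -/

/-- Two vertices of the graph with edges `E`, sources `s` and targets `t` are joined by an undirected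
path with edges in `P`. -/
def Joined (s t : E → V) (P : Set E) : V → V → Prop :=
  Relation.EqvGen fun x y => ∃ e ∈ P, s e = x ∧ t e = y

/-- The edge `e` has endpoints `x` and `y`. -/
def Joins (s t : E → V) (e : E) (x y : V) : Prop :=
  (s e = x ∧ t e = y) ∨ (s e = y ∧ t e = x)

/-- The connected component of `x` in the graph with edge set `P`. -/
def comp (s t : E → V) (P : Set E) (x : V) : Set V := {y | Joined s t P x y}

theorem mem_comp : y ∈ comp s t P x ↔ Joined s t P x y := Iff.rfl

theorem Joins.symm (h : Joins s t e x y) : Joins s t e y x := Or.symm h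

theorem joins_ends (e : E) : Joins s t e (s e) (t e) := Or.inl ⟨rfl, rfl⟩

theorem Joined.refl (x : V) : Joined s t P x x := Relation.EqvGen.refl x

theorem Joined.symm (h : Joined s t P x y) : Joined s t P y x := Relation.EqvGen.symm _ _ h

theorem Joined.trans (h : Joined s t P x y) (h' : Joined s t P y z) : Joined s t P x z :=
  Relation.EqvGen.trans _ _ _ h h'

theorem Joins.joined (h : Joins s t e x y) (he : e ∈ P) : Joined s t P x y := by
  rcases h with ⟨rfl, rfl⟩ | ⟨rfl, rfl⟩
  · exact Relation.EqvGen.rel _ _ ⟨e, he, rfl, rfl⟩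
  · exact (Relation.EqvGen.rel _ _ ⟨e, he, rfl, rfl⟩ : Joined s t P (s e) (t e)).symm

theorem Joined.map {P : Set E} {Q : Set E'} (f : V → V') (φ : E → E')
    (hs : ∀ e, s' (φ e) = f (s e)) (ht : ∀ e, t' (φ e) = f (t e)) (hP : ∀ e ∈ P, φ e ∈ Q)
    (h : Joined s t P x y) : Joined s' t' Q (f x) (f y) := by
  induction h with
  | rel x y h =>
    obtain ⟨e, he, rfl, rfl⟩ := h
    exact Relation.EqvGen.rel _ _ ⟨φ e, hP e he, hs e, ht e⟩
  | refl x => exact Joined.refl _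
  | symm x y _ ih => exact ih.symm
  | trans x y z _ _ ih ih' => exact ih.trans ih'

theorem Joined.mono (hPQ : P ⊆ Q) (h : Joined s t P x y) : Joined s t Q x y :=
  h.map id id (fun _ => rfl) (fun _ => rfl) hPQ

theorem comp_mono (hPQ : P ⊆ Q) (x : V) : comp s t P x ⊆ comp s t Q x :=
  fun _ h => Joined.mono hPQ h

theorem Joined.comp_eq (h : Joined s t P x y) : comp s t P x = comp s t P y :=
  Set.ext fun _ => ⟨h.symm.trans, h.trans⟩

/-- A property of vertices that is invariant along the edges in `P` is invariant along paths. -/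
theorem Joined.iff_of_forall {R : V → Prop} (h : Joined s t P x y)
    (hR : ∀ e ∈ P, ∀ a b, Joins s t e a b → R a → R b) : R x ↔ R y := by
  induction h with
  | rel x y h =>
    obtain ⟨e, he, rfl, rfl⟩ := h
    exact ⟨hR e he _ _ (joins_ends e), hR e he _ _ (joins_ends e).symm⟩
  | refl x => exact Iff.rfl
  | symm x y _ ih => exact ih.symm
  | trans x y z _ _ ih ih' => exact ih.trans ih'

theorem Joined.restrict_comp (h : Joined s t P x y) (hz : Joined s t P z x) :
    Joined s t {e ∈ P | s e ∈ comp s t P z ∧ t e ∈ comp s t P z} x y := by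
  refine (h.iff_of_forall (R := fun w => Joined s t P z w ∧
    Joined s t {e ∈ P | s e ∈ comp s t P z ∧ t e ∈ comp s t P z} x w) ?_).1 ⟨hz, Joined.refl x⟩ |>.2
  rintro e he a b hab ⟨ha, ha'⟩
  have hb := ha.trans (hab.joined he)
  refine ⟨hb, ha'.trans (hab.joined ⟨he, ?_⟩)⟩
  rcases hab with ⟨rfl, rfl⟩ | ⟨rfl, rfl⟩
  exacts [⟨ha, hb⟩, ⟨hb, ha⟩]

theorem Joined.exists_finite (h : Joined s t P x y) : ∃ D : Set E, D.Finite ∧ Joined s t D x y := by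
  induction h with
  | rel x y h =>
    obtain ⟨e, -, rfl, rfl⟩ := h
    exact ⟨{e}, finite_singleton e, (joins_ends e).joined rfl⟩
  | refl x => exact ⟨∅, finite_empty, Joined.refl _⟩
  | symm x y _ ih =>
    obtain ⟨D, hD, h⟩ := ih
    exact ⟨D, hD, h.symm⟩
  | trans x y z _ _ ih ih' =>
    obtain ⟨D, hD, h⟩ := ih
    obtain ⟨D', hD', h'⟩ := ih'
    exact ⟨D ∪ D', hD.union hD', (h.mono subset_union_left).trans (h'.mono subset_union_right)⟩

/-- A path that leaves a set `C` of vertices does so for a last time. -/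
theorem Joined.exists_exit {C : Set V} (h : Joined s t P x y) (hx : x ∈ C) (hy : y ∉ C) :
    ∃ e ∈ P, ∃ u ∈ C, ∃ w ∉ C, Joins s t e u w ∧
      Joined s t {e ∈ P | s e ∉ C ∧ t e ∉ C} w y := by
  refine ((h.iff_of_forall (R := fun z => z ∈ C ∨ ∃ e ∈ P, ∃ u ∈ C, ∃ w ∉ C, Joins s t e u w ∧
      Joined s t {e ∈ P | s e ∉ C ∧ t e ∉ C} w z) ?_).1 (Or.inl hx)).resolve_left hy
  intro e he a b hab ha
  by_cases hb : b ∈ C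
  · exact Or.inl hb
  right
  by_cases haC : a ∈ C
  · exact ⟨e, he, a, haC, b, hb, hab, Joined.refl _⟩
  · obtain ⟨e', he', u, hu, w, hw, huw, hwa⟩ := ha.resolve_left haC
    refine ⟨e', he', u, hu, w, hw, huw, hwa.trans (hab.joined ⟨he, ?_⟩)⟩
    rcases hab with ⟨rfl, rfl⟩ | ⟨rfl, rfl⟩
    exacts [⟨haC, hb⟩, ⟨hb, haC⟩]

/-! ### Trees, with acyclicity expressed by potentials -/

/-- A tree: a connected graph on which every function on edges is the coboundary of a function on
vertices. -/
structure IsTree (s t : E → V) : Prop where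
  joined : ∀ x y, Joined s t univ x y
  exists_potential : ∀ c : E → ℚ, ∃ p : V → ℚ, ∀ e, p (t e) = p (s e) + c e

namespace IsTree

variable (hT : IsTree s t)
include hT

/-- A potential of the indicator function of `e` is constant along paths avoiding `e` but differs at
its two ends. -/
theorem not_joined (h : Joins s t e x y) : ¬ Joined s t {e}ᶜ x y := by
  classical
  suffices ¬ Joined s t {e}ᶜ (s e) (t e) by
    rcases h with ⟨rfl, rfl⟩ | ⟨rfl, rfl⟩
    exacts [this, fun h => this h.symm]
  intro hj
  obtain ⟨p, hp⟩ := hT.exists_potential (Pi.single e 1)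
  have := (hj.iff_of_forall (R := fun z => p z = p (s e)) (by
    rintro e' he' a b hab ha
    have h0 := hp e'
    rw [Pi.single_eq_of_ne he', add_zero] at h0
    rcases hab with ⟨rfl, rfl⟩ | ⟨rfl, rfl⟩
    exacts [h0.trans ha, h0.symm.trans ha])).1 rfl
  have h1 := hp e
  rw [Pi.single_eq_same] at h1
  linarith

theorem joined_or (h : Joins s t e x y) (z : V) :
    Joined s t {e}ᶜ x z ∨ Joined s t {e}ᶜ y z := by
  refine ((hT.joined x z).iff_of_forall
    (R := fun z => Joined s t {e}ᶜ x z ∨ Joined s t {e}ᶜ y z) ?_).1 (Or.inl (Joined.refl x))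
  intro e' _ a b hab ha
  by_cases hee : e' = e
  · subst hee
    rcases h with ⟨rfl, rfl⟩ | ⟨rfl, rfl⟩ <;> rcases hab with ⟨rfl, rfl⟩ | ⟨rfl, rfl⟩ <;>
      simp [Joined.refl]
  · have := hab.joined (P := {e}ᶜ) hee
    exact ha.imp (·.trans this) (·.trans this)

theorem mem_of_joined (h : Joined s t P (s e) (t e)) : e ∈ P := by
  by_contra he
  exact hT.not_joined (joins_ends e) (h.mono (subset_compl_singleton_iff.2 he))

/-- Distinct vertices `x`, `y` are separated by exactly one edge at `x`. -/
theorem exists_first_edge (hxy : x ≠ y) :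
    ∃ e u, Joins s t e x u ∧ ¬ Joined s t {e}ᶜ x y ∧
      ∀ e' u', Joins s t e' x u' → ¬ Joined s t {e'}ᶜ x y → e' = e := by
  obtain ⟨e, -, u, rfl, w, hw, huw, hwy⟩ :=
    (hT.joined x y).exists_exit (mem_singleton x) (fun h => hxy h.symm)
  have hmem : ∀ e' u', Joins s t e' u u' →
      {e ∈ (univ : Set E) | s e ∉ ({u} : Set V) ∧ t e ∉ ({u} : Set V)} ⊆ {e'}ᶜ := by
    rintro e' u' (⟨h, -⟩ | ⟨-, h⟩) e'' ⟨-, h1, h2⟩ rfl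
    exacts [h1 h, h2 h]
  refine ⟨e, w, huw, fun h => ?_, fun e' u' he' h => ?_⟩
  · exact hT.not_joined huw (h.trans (hwy.mono (hmem e w huw)).symm)
  · by_contra hne
    exact h ((huw.joined (P := {e'}ᶜ) (Ne.symm hne)).trans (hwy.mono (hmem e' u' he')))

end IsTree

/-- A separating edge lies on every path, hence in the finite edge set of any one path. -/
theorem finite_separating (h : Joined s t P x y) : {e | ¬ Joined s t {e}ᶜ x y}.Finite := by
  obtain ⟨D, hD, h⟩ := h.exists_finite
  exact hD.subset fun e he => by_contra fun hd => he (h.mono (subset_compl_singleton_iff.2 hd))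

/-! ### Subtrees: intersection and separation -/

/-- The edges with both endpoints in `A`. -/
def inducedEdges (s t : E → V) (A : Set V) : Set E := {e | s e ∈ A ∧ t e ∈ A}

/-- `A` spans a connected subgraph. -/
def IsConn (s t : E → V) (A : Set V) : Prop :=
  ∀ x ∈ A, ∀ y ∈ A, Joined s t (inducedEdges s t A) x y

/-- Otherwise a path in `A` leaves the component of `x` in `A ∩ B` for the last time through an edge
that leaves `B`. The rest of that path, together with a path in `B`, joins the ends of this edge
without using it. -/
theorem IsTree.isConn_inter (hT : IsTree s t) {A B : Set V} (hA : IsConn s t A)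
    (hB : IsConn s t B) : IsConn s t (A ∩ B) := by
  rintro x ⟨hxA, hxB⟩ y ⟨hyA, hyB⟩
  by_contra hxy
  set C := comp s t (inducedEdges s t (A ∩ B)) x with hC
  have hCAB : ∀ u ∈ C, u ∈ A ∩ B := fun u hu =>
    (Joined.iff_of_forall (R := (· ∈ A ∩ B)) hu (by
      rintro e he a b (⟨rfl, rfl⟩ | ⟨rfl, rfl⟩) -
      exacts [he.2, he.1])).1 ⟨hxA, hxB⟩
  obtain ⟨e, heA, u, hu, w, hw, huw, hwy⟩ :=
    (hA x hxA y hyA).exists_exit (C := C) (Joined.refl x) hxy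
  have hwB : w ∉ B := fun hwB => hw (Joined.trans hu (huw.joined (by
    rcases huw with ⟨rfl, rfl⟩ | ⟨rfl, rfl⟩
    · exact ⟨hCAB _ hu, heA.2, hwB⟩
    · exact ⟨⟨heA.1, hwB⟩, hCAB _ hu⟩)))
  refine hT.not_joined huw (Joined.trans (y := y) ?_ ?_)
  · refine (hB u (hCAB u hu).2 y hyB).mono ?_
    rintro _ h rfl
    rcases huw with ⟨rfl, rfl⟩ | ⟨rfl, rfl⟩
    exacts [hwB h.2, hwB h.1]
  · refine (hwy.mono ?_).symm
    rintro _ ⟨-, h1, h2⟩ rfl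
    rcases huw with ⟨rfl, rfl⟩ | ⟨rfl, rfl⟩
    exacts [h1 hu, h2 hu]

/-- Disjoint subtrees are separated by an edge. -/
theorem IsTree.exists_separating (hT : IsTree s t) {A B : Set V} (hA : IsConn s t A)
    (hB : IsConn s t B) (hAne : A.Nonempty) (hBne : B.Nonempty) (hAB : Disjoint A B) :
    ∃ e, ∀ a ∈ A, ∀ b ∈ B, ¬ Joined s t {e}ᶜ a b := by
  obtain ⟨x, hx⟩ := hAne
  obtain ⟨y, hy⟩ := hBne
  obtain ⟨e, -, u, hu, w, hw, huw, hwy⟩ :=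
    (hT.joined x y).exists_exit hx (disjoint_right.1 hAB hy)
  refine ⟨e, fun a ha b hb hab => hT.not_joined huw ?_⟩
  have h1 : Joined s t {e}ᶜ u a := (hA u hu a ha).mono (by
    rintro _ h rfl
    rcases huw with ⟨rfl, rfl⟩ | ⟨rfl, rfl⟩
    exacts [hw h.2, hw h.1])
  have h2 : Joined s t {e}ᶜ b y := (hB b hb y hy).mono (by
    rintro _ h rfl
    rcases huw with ⟨rfl, rfl⟩ | ⟨rfl, rfl⟩
    exacts [disjoint_left.1 hAB hu h.1, disjoint_left.1 hAB hu h.2])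
  have h3 : Joined s t {e}ᶜ w y := hwy.mono (by
    rintro _ ⟨-, h4, h5⟩ rfl
    rcases huw with ⟨rfl, rfl⟩ | ⟨rfl, rfl⟩
    exacts [h4 hu, h5 hu])
  exact h1.trans (hab.trans (h2.trans h3.symm))

/-! ### Ordered edges, bridges and free actions -/

section Order

variable [LinearOrder E] [LinearOrder E']

/-- An edge is a bridge if both its ends lie in infinite components of the graph of smaller edges. -/
def IsBridge (s t : E → V) (e : E) : Prop :=
  (comp s t (Iio e) (s e)).Infinite ∧ (comp s t (Iio e) (t e)).Infinite

theorem IsBridge.map (f : V → V') (φ : E → E') (hs : ∀ e, s' (φ e) = f (s e))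
    (ht : ∀ e, t' (φ e) = f (t e)) (hf : Function.Injective f) (hφ : StrictMono φ)
    (h : IsBridge s t e) : IsBridge s' t' (φ e) := by
  have key : ∀ x, (comp s t (Iio e) x).Infinite → (comp s' t' (Iio (φ e)) (f x)).Infinite := by
    intro x hx
    refine (hx.image hf.injOn).mono ?_
    rintro _ ⟨y, hy, rfl⟩
    exact Joined.map f φ hs ht (fun e' he' => hφ he') hy
  exact ⟨hs e ▸ key _ h.1, ht e ▸ key _ h.2⟩

/-- A free action of `G` on an oriented graph preserving a linear order of the edges. -/
structure IsFreeAction (G : Type*) [Group G] [MulAction G V] [MulAction G E] (s t : E → V) :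
    Prop where
  src_smul : ∀ (g : G) e, s (g • e) = g • s e
  tgt_smul : ∀ (g : G) e, t (g • e) = g • t e
  free : ∀ (g : G) (v : V), g • v = v → g = 1
  strictMono : ∀ g : G, StrictMono fun e : E => g • e

variable {G : Type*} [Group G] [MulAction G V] [MulAction G E]

namespace IsFreeAction

variable (hG : IsFreeAction G s t)
include hG

theorem joined_smul (g : G) (hPQ : ∀ e ∈ P, g • e ∈ Q) (h : Joined s t P x y) :
    Joined s t Q (g • x) (g • y) :=
  h.map (g • ·) (g • ·) (hG.src_smul g) (hG.tgt_smul g) hPQ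

theorem joins_smul (g : G) (h : Joins s t e x y) : Joins s t (g • e) (g • x) (g • y) := by
  rcases h with ⟨rfl, rfl⟩ | ⟨rfl, rfl⟩
  exacts [Or.inl ⟨hG.src_smul g e, hG.tgt_smul g e⟩, Or.inr ⟨hG.src_smul g e, hG.tgt_smul g e⟩]

theorem free_edge (g : G) (e : E) (h : g • e = e) : g = 1 :=
  hG.free g (s e) (by rw [← hG.src_smul, h])

theorem isBridge_smul (g : G) : IsBridge s t (g • e) ↔ IsBridge s t e := by
  have key : ∀ (g : G) (e : E), IsBridge s t e → IsBridge s t (g • e) := fun g e h =>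
    h.map (g • ·) (g • ·) (hG.src_smul g) (hG.tgt_smul g) (MulAction.injective g) (hG.strictMono g)
  refine ⟨fun h => ?_, key g e⟩
  simpa using key g⁻¹ _ h

/-- By invariance of the order, `g` moves `e` strictly up or strictly down, and each further power
continues in the same direction. -/
theorem injective_pow {g : G} (hg : g ≠ 1) (e : E) : Function.Injective fun n : ℕ => g ^ n • e := by
  rcases lt_trichotomy e (g • e) with h | h | h
  · refine (strictMono_nat_of_lt_succ fun n => ?_).injective
    simpa [pow_succ, mul_smul] using hG.strictMono (g ^ n) h
  · exact absurd (hG.free_edge g e h.symm) hg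
  · refine (strictAnti_nat_of_succ_lt fun n => ?_).injective
    simpa [pow_succ, mul_smul] using hG.strictMono (g ^ n) h

theorem infinite_of_ne_one {g : G} (hg : g ≠ 1) (e : E) : Infinite G :=
  Infinite.of_injective (fun n : ℕ => g ^ n) fun n m h =>
    hG.injective_pow hg e (congrArg (· • e) h : g ^ n • e = g ^ m • e)

/-- Finite components of initial segments of the edges meet each orbit at most once. -/
theorem injOn_comp (hP : IsLowerSet P) {v : V} (hfin : (comp s t P v).Finite) :
    InjOn (Quotient.mk (MulAction.orbitRel G V)) (comp s t P v) := by
  -- A nontrivial `g` mapping the component into itself would put infinitely many points `g ^ n • w`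
  -- in it.
  have stable : ∀ g : G, ∀ w ∈ comp s t P v, (∀ y ∈ comp s t P v, g • y ∈ comp s t P v) →
      g = 1 := by
    intro g w hw hg
    by_contra hg1
    rcases isEmpty_or_nonempty E with hE | ⟨⟨e⟩⟩
    · have hsub : ∀ y ∈ comp s t P v, v = y := fun y hy =>
        (Joined.iff_of_forall (R := fun z => v = z) hy fun e => hE.elim e).1 rfl
      exact hg1 (hG.free g w ((hsub _ (hg w hw)).symm.trans (hsub w hw)))
    · refine Set.infinite_of_injective_forall_mem (f := fun n : ℕ => g ^ n • w) ?_ ?_ hfin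
      · intro n m h
        have : g ^ n = g ^ m := by
          rw [← inv_mul_eq_one]
          exact (hG.free _ w (by rw [mul_smul]; simp only at h; rw [← h, inv_smul_smul]))
        exact hG.injective_pow hg1 e (congrArg (· • e) this : g ^ n • e = g ^ m • e)
      · intro n
        induction n with
        | zero => simpa using hw
        | succ n ih =>
          rw [pow_succ', mul_smul]
          exact hg _ ih
  intro u hu w hw huw
  obtain ⟨g, rfl⟩ : ∃ g : G, g • w = u := Quotient.exact huw
  have hlow : IsLowerSet {e | g⁻¹ • e ∈ P} := fun a b hba ha =>
    hP ((hG.strictMono g⁻¹).monotone hba) ha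
  suffices g = 1 by rw [this, one_smul]
  -- Lower sets of a linear order are comparable, so `P` and its translate are nested, and `g` or
  -- its inverse maps the component into itself.
  rcases hP.total hlow with h | h
  · refine inv_eq_one.1 (stable g⁻¹ w hw fun y hy => ?_)
    have : Joined s t P (g • w) y := Joined.trans (Joined.symm hu) hy
    have := hG.joined_smul g⁻¹ (Q := P) (fun e he => h he) this
    rw [inv_smul_smul] at this
    exact Joined.trans hw this
  · refine stable g w hw fun y hy => ?_
    have : Joined s t P w y := Joined.trans (Joined.symm hw) hy
    exact Joined.trans hu (hG.joined_smul g
      (fun e he => h (show g⁻¹ • g • e ∈ P by rwa [inv_smul_smul])) this)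

theorem ncard_comp_le [Finite (MulAction.orbitRel.Quotient G V)] (hP : IsLowerSet P) {v : V}
    (hfin : (comp s t P v).Finite) :
    (comp s t P v).ncard ≤ Nat.card (MulAction.orbitRel.Quotient G V) := by
  rw [← (hG.injOn_comp hP hfin).ncard_image, ← Set.ncard_univ]
  exact ncard_le_ncard (subset_univ _)

theorem finite_incident [Finite (MulAction.orbitRel.Quotient G E)] (v : V) :
    {e | s e = v ∨ t e = v}.Finite := by
  refine Set.Finite.union (s := {e | s e = v}) (t := {e | t e = v}) ?_ ?_
  · refine Set.Finite.of_finite_image (f := Quotient.mk (MulAction.orbitRel G E))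
      (Set.toFinite (α := MulAction.orbitRel.Quotient G E) _) ?_
    intro a ha b hb hab
    obtain ⟨g, rfl⟩ : ∃ g : G, g • b = a := Quotient.exact hab
    simp only [mem_ofPred_eq] at ha hb
    rw [hG.free g v (by rw [← hb, ← hG.src_smul, ha, hb]), one_smul]
  · refine Set.Finite.of_finite_image (f := Quotient.mk (MulAction.orbitRel G E))
      (Set.toFinite (α := MulAction.orbitRel.Quotient G E) _) ?_
    intro a ha b hb hab
    obtain ⟨g, rfl⟩ : ∃ g : G, g • b = a := Quotient.exact hab
    simp only [mem_ofPred_eq] at ha hb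
    rw [hG.free g v (by rw [← hb, ← hG.tgt_smul, ha, hb]), one_smul]

/-- No well-ordering is available, but finite components of lower sets have bounded size, so there
is a largest one containing `v`. Its boundary is finite, and nonempty since `V` is infinite. Adding
the least boundary edge enlarges the component, which by maximality becomes infinite. -/
theorem exists_threshold (hT : IsTree s t) [Infinite V]
    [Finite (MulAction.orbitRel.Quotient G V)] [Finite (MulAction.orbitRel.Quotient G E)] (v : V) :
    ∃ e, (comp s t (Iio e) v).Finite ∧ (comp s t (Iic e) v).Infinite := by
  set N : Set ℕ := {n | ∃ P : Set E, IsLowerSet P ∧ (comp s t P v).Finite ∧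
    (comp s t P v).ncard = n} with hN
  have hempty : comp s t (∅ : Set E) v ⊆ {v} := fun y hy =>
    ((Joined.iff_of_forall (R := fun z => z = v) hy fun e he => absurd he (by simp)).1 rfl)
  have hNne : N.Nonempty := ⟨_, ∅, isLowerSet_empty, (finite_singleton v).subset hempty, rfl⟩
  have hNbdd : BddAbove N := ⟨Nat.card (MulAction.orbitRel.Quotient G V), by
    rintro _ ⟨P, hP, hfin, rfl⟩
    exact hG.ncard_comp_le hP hfin⟩
  obtain ⟨P, hP, hfin, hcard⟩ := Nat.sSup_mem hNne hNbdd
  have hmax : ∀ Q : Set E, IsLowerSet Q → (comp s t Q v).Finite →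
      (comp s t Q v).ncard ≤ (comp s t P v).ncard := fun Q hQ hQfin =>
    hcard ▸ le_csSup hNbdd ⟨Q, hQ, hQfin, rfl⟩
  set M := comp s t P v with hM
  set D : Set E := {e | ∃ x ∈ M, ∃ y ∉ M, Joins s t e x y} with hD
  have hDfin : D.Finite := by
    refine (hfin.biUnion fun x _ => hG.finite_incident x).subset ?_
    rintro e ⟨x, hx, y, -, h⟩
    refine mem_biUnion hx ?_
    rcases h with ⟨h, -⟩ | ⟨-, h⟩
    exacts [Or.inl h, Or.inr h]
  have hDne : D.Nonempty := by
    obtain ⟨y, hy⟩ := hfin.exists_notMem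
    obtain ⟨e, -, u, hu, w, hw, huw, -⟩ :=
      (hT.joined v y).exists_exit (C := M) (Joined.refl v) hy
    exact ⟨e, u, hu, w, hw, huw⟩
  obtain ⟨e, ⟨x, hx, y, hy, hxy⟩, hmin⟩ := hDfin.exists_minimal hDne
  have heP : e ∉ P := fun he => hy (Joined.trans hx (hxy.joined he))
  have hPe : P ⊆ Iio e := fun e' he' => lt_of_not_ge fun h => heP (hP h he')
  have hMe : comp s t (Iio e) v ⊆ M := fun z hz =>
    (Joined.iff_of_forall (R := (· ∈ M)) hz (by
      intro e' he' a b hab ha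
      by_contra hb
      exact absurd (hmin ⟨a, ha, b, hb, hab⟩ (le_of_lt he')) (not_le_of_gt he'))).1 (Joined.refl v)
  refine ⟨e, hfin.subset hMe, fun hfin' => ?_⟩
  have hlt : M ⊂ comp s t (Iic e) v := by
    refine ⟨comp_mono (hPe.trans fun _ h => le_of_lt h) v, fun h => hy (h ?_)⟩
    exact Joined.trans (Joined.mono (hPe.trans fun _ h => le_of_lt h) hx)
      (hxy.joined (le_refl e))
  exact absurd (hmax _ (isLowerSet_Iic e) hfin') (not_le_of_gt (ncard_lt_ncard hlt hfin'))

end IsFreeAction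

/-! ### Outlets, and the count of bridge orbits -/

/-- `y` is the vertex through which the component of `v` in the graphs of small edges first becomes
infinite, and `τ` is the edge leading to it. -/
structure IsOutlet (s t : E → V) (v : V) (τ : E) (y : V) : Prop where
  finite : (comp s t (Iio τ) v).Finite
  infinite : (comp s t (Iic τ) v).Infinite
  not_joined : ¬ Joined s t (Iio τ) v y
  exists_joins : ∃ x, Joined s t (Iio τ) v x ∧ Joins s t τ x y

theorem exists_isOutlet {v : V} {τ : E} (h : (comp s t (Iio τ) v).Finite)
    (h' : (comp s t (Iic τ) v).Infinite) : ∃ y, IsOutlet s t v τ y := by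
  by_contra! hno
  refine h' (h.subset fun z hz => ?_)
  refine (Joined.iff_of_forall (R := (· ∈ comp s t (Iio τ) v)) hz ?_).1 (Joined.refl v)
  intro e he a b hab ha
  rcases eq_or_lt_of_le (show e ≤ τ from he) with rfl | hlt
  · by_contra hb
    exact hno b ⟨h, h', hb, a, ha, hab⟩
  · exact Joined.trans ha (hab.joined hlt)

theorem le_of_infinite_of_finite {v : V} {e e' : E} (h : (comp s t (Iic e) v).Infinite)
    (h' : (comp s t (Iio e') v).Finite) : e' ≤ e :=
  le_of_not_gt fun hlt => h (h'.subset (comp_mono (fun _ ha => lt_of_le_of_lt ha hlt) v))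

theorem IsOutlet.edge_unique {v : V} {τ τ' : E} (h : IsOutlet s t v τ x)
    (h' : IsOutlet s t v τ' y) : τ = τ' :=
  le_antisymm (le_of_infinite_of_finite h'.infinite h.finite)
    (le_of_infinite_of_finite h.infinite h'.finite)

theorem IsOutlet.unique {v : V} {τ τ' : E} (h : IsOutlet s t v τ x) (h' : IsOutlet s t v τ' y) :
    x = y := by
  obtain rfl := h.edge_unique h'
  obtain ⟨a, ha, hax⟩ := h.exists_joins
  obtain ⟨b, hb, hby⟩ := h'.exists_joins
  rcases hax with ⟨rfl, rfl⟩ | ⟨rfl, rfl⟩ <;> rcases hby with ⟨rfl, rfl⟩ | ⟨rfl, rfl⟩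
  · rfl
  · exact absurd ha h'.not_joined
  · exact absurd ha h'.not_joined
  · rfl

theorem IsOutlet.congr {v w : V} {τ : E} (h : IsOutlet s t v τ y)
    (hvw : Joined s t (Iio τ) v w) : IsOutlet s t w τ y where
  finite := hvw.comp_eq ▸ h.finite
  infinite := (hvw.mono Iio_subset_Iic_self).comp_eq ▸ h.infinite
  not_joined := fun hw => h.not_joined (hvw.trans hw)
  exists_joins := h.exists_joins.imp fun _ hx => ⟨hvw.symm.trans hx.1, hx.2⟩

theorem IsOutlet.joined {v : V} {τ : E} (h : IsOutlet s t v τ y) : Joined s t (Iic τ) v y := by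
  obtain ⟨x, hx, hxy⟩ := h.exists_joins
  exact (hx.mono Iio_subset_Iic_self).trans (hxy.joined (le_refl τ))

theorem IsOutlet.smul (hG : IsFreeAction G s t) {v : V} {τ : E} (h : IsOutlet s t v τ y) (g : G) :
    IsOutlet s t (g • v) (g • τ) (g • y) := by
  have hlt : ∀ e, e < g • τ ↔ g⁻¹ • e < τ := fun e => by
    conv_lhs => rw [← smul_inv_smul g e]
    exact (hG.strictMono g).lt_iff_lt
  have hle : ∀ e, e ≤ g • τ ↔ g⁻¹ • e ≤ τ := fun e => by
    conv_lhs => rw [← smul_inv_smul g e]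
    exact (hG.strictMono g).le_iff_le
  refine ⟨?_, ?_, fun h' => h.not_joined ?_, ?_⟩
  · refine (h.finite.image (g • ·)).subset fun z hz => ⟨g⁻¹ • z, ?_, smul_inv_smul g z⟩
    simpa [mem_comp] using hG.joined_smul g⁻¹ (Q := Iio τ) (fun e he => (hlt e).1 he) hz
  · refine (h.infinite.image (MulAction.injective g).injOn).mono ?_
    rintro _ ⟨z, hz, rfl⟩
    exact hG.joined_smul g (fun e he => (hle _).2 (by simpa using he)) hz
  · simpa using hG.joined_smul g⁻¹ (Q := Iio τ) (fun e he => (hlt e).1 he) h'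
  · obtain ⟨x, hx, hxy⟩ := h.exists_joins
    exact ⟨g • x, hG.joined_smul g (fun e he => (hlt _).2 (by simpa using he)) hx,
      hG.joins_smul g hxy⟩

/-- The vertices of an ordered tree correspond equivariantly to the edges that are not bridges. -/
theorem IsFreeAction.exists_equivariant (hG : IsFreeAction G s t) (hT : IsTree s t) [Infinite V]
    [Finite (MulAction.orbitRel.Quotient G V)] [Finite (MulAction.orbitRel.Quotient G E)] :
    ∃ f : V → E, Function.Injective f ∧ (∀ e, e ∈ range f ↔ ¬ IsBridge s t e) ∧
      ∀ (g : G) v, f (g • v) = g • f v := by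
  have hout : ∀ v, ∃ τ y, IsOutlet s t v τ y := fun v => by
    obtain ⟨τ, h, h'⟩ := hG.exists_threshold hT v
    exact ⟨τ, exists_isOutlet h h'⟩
  choose τ out hout using hout
  have hne : ∀ v, v ≠ out v := fun v h => (hout v).not_joined (h ▸ Joined.refl v)
  -- `f v` is the first edge on the path from `v` to its outlet.
  choose f nb hf hsep huniq using fun v => hT.exists_first_edge (hne v)
  have hle : ∀ v, f v ≤ τ v := fun v => le_of_not_gt fun h =>
    hsep v ((hout v).joined.mono fun e he => ne_of_lt (lt_of_le_of_lt he h))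
  have hout_congr : ∀ v w, Joined s t (Iio (τ v)) v w → out w = out v := fun v w h =>
    (hout w).unique ((hout v).congr h)
  refine ⟨f, ?_, ?_, ?_⟩
  · intro v w hvw
    by_contra hne'
    -- An edge shared by distinct `v` and `w` joins them. If it is the threshold of both, the
    -- infinite component is covered by two finite ones. Otherwise `v` and `w` have the same outlet,
    -- and the edge cannot separate both of its ends from it.
    have hj : Joins s t (f v) v w := by
      have h1 := hf v
      have h2 := hf w
      rw [← hvw] at h2
      rcases h1 with ⟨h1, h1'⟩ | ⟨h1, h1'⟩ <;> rcases h2 with ⟨h2, h2'⟩ | ⟨h2, h2'⟩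
      · exact absurd (h1.symm.trans h2) hne'
      · exact Or.inl ⟨h1, h2'⟩
      · exact Or.inr ⟨h2, h1'⟩
      · exact absurd (h1'.symm.trans h2') hne'
    rcases eq_or_lt_of_le (hle v) with hv | hv
    · rcases eq_or_lt_of_le (hle w) with hw | hw
      · have hτ : τ v = τ w := by rw [← hv, ← hw, hvw]
        refine (hout v).infinite
          (((hout v).finite.union (hτ ▸ (hout w).finite)).subset fun z hz => ?_)
        refine (Joined.iff_of_forall
          (R := (· ∈ comp s t (Iio (τ v)) v ∪ comp s t (Iio (τ v)) w)) hz ?_).1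
          (Or.inl (Joined.refl v))
        intro e he a b hab ha
        rcases eq_or_lt_of_le (show e ≤ τ v from he) with rfl | hlt
        · rw [hv] at hj
          have hb : b = v ∨ b = w := by
            rcases hj with ⟨h1, h2⟩ | ⟨h1, h2⟩ <;> rcases hab with ⟨h3, h4⟩ | ⟨h3, h4⟩
            exacts [Or.inr (h4.symm.trans h2), Or.inl (h3.symm.trans h1),
              Or.inl (h4.symm.trans h2), Or.inr (h3.symm.trans h1)]
          rcases hb with rfl | rfl
          exacts [Or.inl (Joined.refl _), Or.inr (Joined.refl _)]
        · exact ha.imp (fun h => Joined.trans h (hab.joined hlt))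
            (fun h => Joined.trans h (hab.joined hlt))
      · have ho := hout_congr w v (hj.symm.joined (hvw ▸ hw))
        rcases hT.joined_or hj (out v) with h | h
        · exact hsep v h
        · exact hsep w (by rwa [← hvw, ← ho])
    · have ho := hout_congr v w (hj.joined hv)
      rcases hT.joined_or hj (out v) with h | h
      · exact hsep v h
      · exact hsep w (by rwa [← hvw, ho])
  · intro e
    constructor
    · rintro ⟨v, rfl⟩ hb
      have hfin := (hout v).finite.subset (comp_mono (Iio_subset_Iio (hle v)) v)
      rcases hf v with ⟨h, -⟩ | ⟨-, h⟩
      · exact hb.1 (by rwa [h])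
      · exact hb.2 (by rwa [h])
    · intro hb
      -- Let `x` be an end whose component is finite. If `e` is the threshold of `x`, then `y` is
      -- the outlet of `x`. If `e` is smaller, both ends have the same outlet, and `e` separates one
      -- of them from it.
      obtain ⟨x, y, hxy, hfin⟩ : ∃ x y, Joins s t e x y ∧ (comp s t (Iio e) x).Finite := by
        by_cases h : (comp s t (Iio e) (s e)).Finite
        · exact ⟨_, _, joins_ends e, h⟩
        · refine ⟨_, _, (joins_ends e).symm, ?_⟩
          by_contra h'
          exact hb ⟨h, h'⟩
      have hex : e ≤ τ x := le_of_infinite_of_finite (hout x).infinite hfin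
      rcases eq_or_lt_of_le hex with rfl | hlt
      · refine ⟨x, (huniq x (τ x) y hxy ?_).symm⟩
        have : out x = y := by
          by_contra hne'
          obtain ⟨a, ha, hay⟩ := (hout x).exists_joins
          rcases hxy with ⟨h1, h2⟩ | ⟨h1, h2⟩ <;> rcases hay with ⟨h3, h4⟩ | ⟨h3, h4⟩
          · exact hne' (h4.symm.trans h2)
          · exact hne x (h1.symm.trans h3)
          · exact hne x (h2.symm.trans h4)
          · exact hne' (h3.symm.trans h1)
        rw [this]
        exact hT.not_joined hxy
      · have ho := hout_congr x y (hxy.joined hlt)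
        by_cases h : Joined s t {e}ᶜ x (out x)
        · refine ⟨y, (huniq y e x hxy.symm fun h' => hT.not_joined hxy ?_).symm⟩
          rw [ho] at h'
          exact h.trans h'.symm
        · exact ⟨x, (huniq x e y hxy h).symm⟩
  · intro g v
    have ho : out (g • v) = g • out v := (hout (g • v)).unique ((hout v).smul hG g)
    refine (huniq (g • v) (g • f v) (g • nb v) (hG.joins_smul g (hf v)) fun h => hsep v ?_).symm
    have := hG.joined_smul g⁻¹ (P := {g • f v}ᶜ) (Q := {f v}ᶜ)
      (fun e he => fun he' => he (inv_smul_eq_iff.1 he')) h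
    simpa [ho] using this

/-- The orbits of bridges. -/
abbrev BridgeOrbit (G : Type*) [Group G] [MulAction G E] (s t : E → V) :=
  {q : MulAction.orbitRel.Quotient G E // IsBridge s t q.out}

theorem IsFreeAction.isBridge_out_mk (hG : IsFreeAction G s t) :
    IsBridge s t (Quotient.out (Quotient.mk (MulAction.orbitRel G E) e)) ↔ IsBridge s t e := by
  obtain ⟨g, hg⟩ : ∃ g : G, g • e = Quotient.out (Quotient.mk (MulAction.orbitRel G E) e) :=
    Quotient.mk_out (s := MulAction.orbitRel G E) e
  rw [← hg, hG.isBridge_smul]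

/-- The equivariant bijection from vertices to edges that are not bridges descends to orbits, so
bridge orbits count minus the Euler characteristic of the quotient graph. -/
theorem IsFreeAction.card_bridgeOrbit (hG : IsFreeAction G s t) (hT : IsTree s t) [Infinite V]
    [Finite (MulAction.orbitRel.Quotient G V)] [Finite (MulAction.orbitRel.Quotient G E)] :
    Nat.card (MulAction.orbitRel.Quotient G V) + Nat.card (BridgeOrbit G s t) =
      Nat.card (MulAction.orbitRel.Quotient G E) := by
  classical
  obtain ⟨f, hinj, hrange, hequiv⟩ := hG.exists_equivariant hT
  have e1 : MulAction.orbitRel.Quotient G V ≃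
      {q : MulAction.orbitRel.Quotient G E // ¬ IsBridge s t q.out} := by
    refine Equiv.ofBijective (fun q => ⟨Quotient.mk _ (f q.out), ?_⟩) ⟨?_, ?_⟩
    · rw [hG.isBridge_out_mk, ← hrange]
      exact mem_range_self _
    · intro q q' h
      obtain ⟨g, hg⟩ : ∃ g : G, g • f q'.out = f q.out := Quotient.exact (Subtype.ext_iff.1 h)
      rw [← hequiv] at hg
      rw [← q.out_eq, ← q'.out_eq]
      exact Quotient.sound ⟨g, hinj hg⟩
    · rintro ⟨q, hq⟩
      obtain ⟨v, hv⟩ := (hrange _).2 hq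
      obtain ⟨g, hg⟩ : ∃ g : G, g • v = Quotient.out (Quotient.mk (MulAction.orbitRel G V) v) :=
        Quotient.mk_out (s := MulAction.orbitRel G V) v
      refine ⟨Quotient.mk _ v, Subtype.ext ?_⟩
      change Quotient.mk _ (f (Quotient.out (Quotient.mk (MulAction.orbitRel G V) v))) = q
      rw [← hg, hequiv, hv]
      conv_rhs => rw [← q.out_eq]
      exact Quotient.sound ⟨g, rfl⟩
  rw [Nat.card_congr e1, add_comm, ← Nat.card_sum]
  exact Nat.card_congr (Equiv.sumCompl _)

end Order

end OrderedTree

/-! ### Homomorphisms to ℚ and the Euler characteristic -/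

namespace OrderedTree

open Set

section Cohomology

variable {V E : Type*} {s t : E → V} [LinearOrder E] {G : Type*} [Group G] [MulAction G V]
  [MulAction G E]

/-- The functions on `V` that are invariant under `G` up to a homomorphism to `ℚ`. -/
def quasiInvariant (G V : Type*) [Group G] [MulAction G V] :
    Submodule ℚ ((V → ℚ) × (Additive G →+ ℚ)) where
  carrier := {p | ∀ (g : G) v, p.1 (g • v) = p.1 v + p.2 (Additive.ofMul g)}
  add_mem' := fun ha hb g v => by
    have h1 := ha g v
    have h2 := hb g v
    simp only [Prod.fst_add, Prod.snd_add, Pi.add_apply, AddMonoidHom.add_apply, h1, h2]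
    ring
  zero_mem' := fun g v => by simp
  smul_mem' := fun c a ha g v => by
    have h1 := ha g v
    simp only [Prod.smul_fst, Prod.smul_snd, Pi.smul_apply, AddMonoidHom.smul_apply, smul_eq_mul,
      h1]
    ring

omit [LinearOrder E] in
theorem Joined.eq_add_of_coboundary_eq_zero {p : V → ℚ} (hp : ∀ e, p (t e) = p (s e)) {x y : V}
    (h : Joined s t univ x y) : p x = p y :=
  (h.iff_of_forall (R := fun z => p x = p z) (by
    rintro e - a b (⟨rfl, rfl⟩ | ⟨rfl, rfl⟩) h
    exacts [h.trans (hp e).symm, h.trans (hp e)])).1 rfl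

namespace IsFreeAction

variable (hG : IsFreeAction G s t)
include hG

/-- The Euler characteristic formula for a group acting freely on a tree. -/
theorem finrank_hom_add_card (hT : IsTree s t) [Nonempty V]
    [Finite (MulAction.orbitRel.Quotient G V)] [Finite (MulAction.orbitRel.Quotient G E)] :
    Module.Finite ℚ (Additive G →+ ℚ) ∧
    Module.finrank ℚ (Additive G →+ ℚ) + Nat.card (MulAction.orbitRel.Quotient G V) =
      Nat.card (MulAction.orbitRel.Quotient G E) + 1 := by
  classical
  let Z := quasiInvariant G V
  obtain ⟨v₀⟩ := ‹Nonempty V›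
  let mkE : E → MulAction.orbitRel.Quotient G E := Quotient.mk _
  let mkV : V → MulAction.orbitRel.Quotient G V := Quotient.mk _
  have outE : ∀ e, ∃ g : G, g • e = (mkE e).out := fun e =>
    Quotient.mk_out (s := MulAction.orbitRel G E) e
  have outV : ∀ v, ∃ g : G, g • v = (mkV v).out := fun v =>
    Quotient.mk_out (s := MulAction.orbitRel G V) v
  have mkE_smul : ∀ (g : G) e, mkE (g • e) = mkE e := fun g e => Quotient.sound ⟨g, rfl⟩
  have mkV_smul : ∀ (g : G) v, mkV (g • v) = mkV v := fun g v => Quotient.sound ⟨g, rfl⟩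
  -- The dimension of `Z` is computed twice. Here a quasi-invariant function corresponds to its
  -- coboundary, which is invariant and so lives on edge orbits, and its value at `v₀`.
  let δ : Z →ₗ[ℚ] (MulAction.orbitRel.Quotient G E → ℚ) × ℚ :=
    { toFun := fun p => (fun q => p.1.1 (t q.out) - p.1.1 (s q.out), p.1.1 v₀)
      map_add' := fun a b => by
        refine Prod.ext (funext fun q => ?_) rfl
        simp only [Submodule.coe_add, Prod.fst_add, Pi.add_apply]
        ring
      map_smul' := fun c a => by
        refine Prod.ext (funext fun q => ?_) rfl
        simp only [Submodule.coe_smul, Prod.smul_fst, Pi.smul_apply, smul_eq_mul,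
          RingHom.id_apply]
        ring }
  have hδ : Function.Bijective δ := by
    constructor
    · rw [← LinearMap.ker_eq_bot, LinearMap.ker_eq_bot']
      rintro ⟨⟨p, φ⟩, hp⟩ h
      have hp : ∀ (g : G) v, p (g • v) = p v + φ (Additive.ofMul g) := hp
      have h1 : ∀ q : MulAction.orbitRel.Quotient G E, p (t q.out) - p (s q.out) = 0 := fun q =>
        congrFun (congrArg Prod.fst h) q
      have h2 : p v₀ = 0 := congrArg Prod.snd h
      have h3 : ∀ e, p (t e) = p (s e) := fun e => by
        obtain ⟨g, hg⟩ := outE e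
        have := h1 (mkE e)
        rw [← hg, hG.src_smul, hG.tgt_smul, hp, hp] at this
        linarith
      have h4 : ∀ v, p v = 0 := fun v =>
        (Joined.eq_add_of_coboundary_eq_zero h3 (hT.joined v v₀)).trans h2
      refine Subtype.ext (Prod.ext (funext h4) (AddMonoidHom.ext fun g => ?_))
      have := hp (Additive.toMul g) v₀
      rw [h4, h4] at this
      change φ g = 0
      simpa using this.symm
    · rintro ⟨c, a⟩
      obtain ⟨p, hp⟩ := hT.exists_potential fun e => c (mkE e)
      -- Since `c` is lifted invariantly, `p` and its translate have the same coboundary, so they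
      -- differ by a constant. This constant is additive in `g`.
      have h1 : ∀ (g : G) v, p (g • v) - p v = p (g • v₀) - p v₀ := fun g v =>
        Joined.eq_add_of_coboundary_eq_zero (p := fun v => p (g • v) - p v) (fun e => by
          have := hp (g • e)
          rw [hG.src_smul, hG.tgt_smul, mkE_smul] at this
          simp only [this, hp e]
          ring) (hT.joined v v₀)
      let φ : Additive G →+ ℚ := AddMonoidHom.mk' (fun g => p (Additive.toMul g • v₀) - p v₀)
        (fun g h => by
          have := h1 (Additive.toMul g) (Additive.toMul h • v₀)
          rw [toMul_add, mul_smul]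
          linarith)
      refine ⟨⟨(fun v => p v - p v₀ + a, φ), fun g v => ?_⟩, ?_⟩
      · have := h1 g v
        change p (g • v) - p v₀ + a = p v - p v₀ + a + (p (g • v₀) - p v₀)
        linarith
      · refine Prod.ext (funext fun q => ?_) ?_
        · change p (t q.out) - p v₀ + a - (p (s q.out) - p v₀ + a) = c q
          rw [hp, show mkE q.out = q from q.out_eq]
          ring
        · change p v₀ - p v₀ + a = a
          ring
  let eδ := LinearEquiv.ofBijective δ hδ
  have hZfin : Module.Finite ℚ Z := Module.Finite.equiv eδ.symm
  have hZ : Module.finrank ℚ Z = Nat.card (MulAction.orbitRel.Quotient G E) + 1 := by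
    have := Fintype.ofFinite (MulAction.orbitRel.Quotient G E)
    rw [eδ.finrank_eq, Module.finrank_prod, Module.finrank_self, Module.finrank_fintype_fun_eq_card,
      Nat.card_eq_fintype_card]
  -- The second computation: projection to homomorphisms is onto because the vertices form free
  -- orbits, and its kernel is the space of functions on vertex orbits.
  let π : Z →ₗ[ℚ] (Additive G →+ ℚ) := (LinearMap.snd ℚ _ _).comp Z.subtype
  have hπ : Function.Surjective π := fun φ => by
    choose γ hγ using outV
    have hγ_smul : ∀ (g : G) v, γ (g • v) * g = γ v := fun g v => by
      rw [← inv_mul_eq_one]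
      refine hG.free _ v ?_
      rw [mul_smul, inv_smul_eq_iff, mul_smul, hγ, hγ, mkV_smul]
    refine ⟨⟨(fun v => -φ (Additive.ofMul (γ v)), φ), fun g v => ?_⟩, rfl⟩
    change -φ (Additive.ofMul (γ (g • v))) = -φ (Additive.ofMul (γ v)) + φ (Additive.ofMul g)
    rw [← hγ_smul g v, ofMul_mul, map_add]
    ring
  let ι : (MulAction.orbitRel.Quotient G V → ℚ) →ₗ[ℚ] LinearMap.ker π :=
    { toFun := fun p => ⟨⟨(fun v => p (mkV v), 0), fun g v => by
        simp only [mkV_smul]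
        simp⟩, rfl⟩
      map_add' := fun a b => Subtype.ext (Subtype.ext (Prod.ext rfl (by simp)))
      map_smul' := fun a b => Subtype.ext (Subtype.ext (Prod.ext rfl (by simp))) }
  have hι : Function.Bijective ι := by
    constructor
    · intro p p' h
      funext q
      have := congrFun (congrArg (fun z : LinearMap.ker π => z.1.1.1) h) q.out
      change p (mkV q.out) = p' (mkV q.out) at this
      rwa [show mkV q.out = q from q.out_eq] at this
    · rintro ⟨⟨⟨p, φ⟩, hp⟩, h⟩
      have h : φ = 0 := h
      subst h
      have hp : ∀ (g : G) v, p (g • v) = p v + (0 : Additive G →+ ℚ) (Additive.ofMul g) := hp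
      refine ⟨fun q => p q.out, Subtype.ext (Subtype.ext (Prod.ext (funext fun v => ?_) rfl))⟩
      change p (mkV v).out = p v
      obtain ⟨g, hg⟩ := outV v
      rw [← hg, hp]
      simp
  have hker : Module.finrank ℚ (LinearMap.ker π) = Nat.card (MulAction.orbitRel.Quotient G V) := by
    have := Fintype.ofFinite (MulAction.orbitRel.Quotient G V)
    rw [← (LinearEquiv.ofBijective ι hι).finrank_eq, Module.finrank_fintype_fun_eq_card,
      Nat.card_eq_fintype_card]
  refine ⟨Module.Finite.of_surjective π hπ, ?_⟩
  rw [← hZ, ← hker, ← LinearMap.finrank_range_add_finrank_ker π, LinearMap.range_eq_top.2 hπ,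
    finrank_top]

/-- A nontrivial group preserving the order is infinite, which gives the infinite vertex set needed
by `card_bridgeOrbit`. -/
theorem finrank_hom (hT : IsTree s t) [Nonempty V] (hne : ∃ g : G, g ≠ 1)
    [Finite (MulAction.orbitRel.Quotient G V)] [Finite (MulAction.orbitRel.Quotient G E)] :
    Module.finrank ℚ (Additive G →+ ℚ) = Nat.card (BridgeOrbit G s t) + 1 := by
  obtain ⟨g, hg⟩ := hne
  obtain ⟨v⟩ := ‹Nonempty V›
  have hE : Nonempty E := by
    by_contra hE
    rw [not_nonempty_iff] at hE
    exact hg (hG.free g v ((Joined.iff_of_forall (R := fun z => z = v) (hT.joined v (g • v))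
      fun e => hE.elim e).1 rfl))
  obtain ⟨e⟩ := hE
  have := hG.infinite_of_ne_one hg e
  have : Infinite V := Infinite.of_injective (fun g : G => g • v) fun g h hgh => by
    rw [← inv_mul_eq_one]
    exact (hG.free _ v (by rw [mul_smul]; exact inv_smul_eq_iff.2 (Eq.symm hgh)))
  have h1 := hG.card_bridgeOrbit hT
  have h2 := (hG.finrank_hom_add_card hT).2
  omega

end IsFreeAction

end Cohomology

end OrderedTree

/-! ### Rank of a free group as the dimension of Hom(G, ℚ) -/

section Rank

open Module

variable {G : Type*} [Group G]

/-- Evaluation of homomorphisms to `ℚ` at elements of `G`. -/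
def evalHom (G : Type*) [Group G] {S : Type*} (b : S → G) : (Additive G →+ ℚ) →ₗ[ℚ] (S → ℚ) where
  toFun φ x := φ (Additive.ofMul (b x))
  map_add' _ _ := rfl
  map_smul' _ _ := rfl

theorem evalHom_injective {T : Finset G} (hT : Subgroup.closure (T : Set G) = ⊤) :
    Function.Injective (evalHom G ((↑) : T → G)) := by
  intro φ ψ h
  have : AddMonoidHom.toMultiplicativeRight φ = AddMonoidHom.toMultiplicativeRight ψ := by
    refine MonoidHom.eq_of_eqOn_dense hT fun x hx => ?_
    exact congrArg Multiplicative.ofAdd (congrFun h ⟨x, hx⟩)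
  exact AddMonoidHom.toMultiplicativeRight.injective this

theorem finrank_hom_le_card {T : Finset G} (hT : Subgroup.closure (T : Set G) = ⊤) :
    finrank ℚ (Additive G →+ ℚ) ≤ T.card := by
  simpa using LinearMap.finrank_le_finrank_of_injective (evalHom_injective hT)

theorem finite_hom_of_fg [hfg : Group.FG G] : Module.Finite ℚ (Additive G →+ ℚ) := by
  obtain ⟨T, hT⟩ := hfg.out
  exact Module.Finite.of_injective _ (evalHom_injective hT)

theorem FreeGroupBasis.closure_range {S : Type*} (b : FreeGroupBasis S G) :
    Subgroup.closure (Set.range b) = ⊤ := by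
  rw [← FreeGroup.lift_surjective_iff_closure_range_eq_top]
  have : FreeGroup.lift b = b.repr.symm.toMonoidHom := FreeGroup.ext_hom _ _ fun x => by
    rw [FreeGroup.lift_apply_of]
    rfl
  rw [this]
  exact b.repr.symm.surjective

/-- A free group with finitely many independent homomorphisms to `ℚ` is finitely generated. -/
theorem IsFreeGroup.fg_and_rank_eq [IsFreeGroup G] [Module.Finite ℚ (Additive G →+ ℚ)] :
    ∃ _ : Group.FG G, Group.rank G = finrank ℚ (Additive G →+ ℚ) := by
  classical
  let S := IsFreeGroup.Generators G
  let b : FreeGroupBasis S G := IsFreeGroup.basis G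
  let r := evalHom G b
  have hr : Function.Surjective r := fun c => by
    refine ⟨AddMonoidHom.toMultiplicativeRight.symm (b.lift fun x => Multiplicative.ofAdd (c x)),
      funext fun x => ?_⟩
    change Multiplicative.toAdd (b.lift (fun x => Multiplicative.ofAdd (c x)) (b x)) = c x
    have h := congrFun (b.lift.symm_apply_apply fun x => Multiplicative.ofAdd (c x)) x
    exact congrArg Multiplicative.toAdd h
  have hfin : Module.Finite ℚ (S → ℚ) := Module.Finite.of_surjective r hr
  -- Every function on the basis extends to a homomorphism, so `S → ℚ` is finite-dimensional, which
  -- forces the basis to be finite.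
  have hS : Finite S := (Pi.linearIndependent_single_one S ℚ).finite
  have := Fintype.ofFinite S
  have hcl : Subgroup.closure (Finset.univ.image b : Set G) = ⊤ := by
    rw [Finset.coe_image, Finset.coe_univ, Set.image_univ]
    exact b.closure_range
  have hfg : Group.FG G := ⟨⟨Finset.univ.image b, hcl⟩⟩
  refine ⟨hfg, le_antisymm ?_ ?_⟩
  · calc Group.rank G ≤ (Finset.univ.image b).card := Group.rank_le hcl
      _ ≤ Fintype.card S := Finset.card_image_le
      _ = finrank ℚ (S → ℚ) := by simp
      _ ≤ finrank ℚ (Additive G →+ ℚ) := by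
        rw [← finrank_top ℚ (S → ℚ), ← LinearMap.range_eq_top.2 hr]
        exact LinearMap.finrank_range_le r
  · obtain ⟨T, hT, hT'⟩ := Group.rank_spec G
    exact (finrank_hom_le_card hT').trans hT.le

theorem IsFreeGroup.rank_eq [IsFreeGroup G] [Group.FG G] :
    Group.rank G = finrank ℚ (Additive G →+ ℚ) :=
  have := finite_hom_of_fg (G := G)
  IsFreeGroup.fg_and_rank_eq.2

end Rank

/-! ### Invariant subtrees with finitely many orbits -/

namespace OrderedTree

open Set MulAction

variable {V E : Type*} {s t : E → V} [LinearOrder E]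

theorem finite_orbits_of_finite {G X : Type*} [Group G] [MulAction G X] {D : Set X}
    (hD : D.Finite) (h : ∀ x : X, ∃ g : G, g • x ∈ D) : Finite (orbitRel.Quotient G X) := by
  have := hD.to_subtype
  choose γ hγ using h
  refine Finite.of_injective (β := D) (fun q : orbitRel.Quotient G X => ⟨γ q.out • q.out, hγ _⟩) ?_
  intro q q' hq
  have hq : γ q.out • q.out = γ q'.out • q'.out := Subtype.ext_iff.1 hq
  rw [← q.out_eq, ← q'.out_eq]
  exact Quotient.sound ⟨(γ q.out)⁻¹ * γ q'.out, by
    simp only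
    rw [mul_smul, ← hq, inv_smul_smul]⟩

section Restrict

variable {G : Type*} [Group G] [MulAction G V] [MulAction G E]

/-- The edges of the subgraph spanned by an invariant set of vertices. -/
def IsFreeAction.edges (hG : IsFreeAction G s t) (A : SubMulAction G V) : SubMulAction G E where
  carrier := inducedEdges s t A
  smul_mem' g e he := by
    refine ⟨?_, ?_⟩
    · rw [hG.src_smul]
      exact A.smul_mem g he.1
    · rw [hG.tgt_smul]
      exact A.smul_mem g he.2

/-- The source map of the subgraph spanned by an invariant set of vertices. -/
def IsFreeAction.src (hG : IsFreeAction G s t) (A : SubMulAction G V) (e : hG.edges A) : A :=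
  ⟨s e, e.2.1⟩

/-- The target map of the subgraph spanned by an invariant set of vertices. -/
def IsFreeAction.tgt (hG : IsFreeAction G s t) (A : SubMulAction G V) (e : hG.edges A) : A :=
  ⟨t e, e.2.2⟩

namespace IsFreeAction

variable (hG : IsFreeAction G s t) {A : SubMulAction G V}

theorem restrict : IsFreeAction G (hG.src A) (hG.tgt A) where
  src_smul g e := Subtype.ext (hG.src_smul g e)
  tgt_smul g e := Subtype.ext (hG.tgt_smul g e)
  free g v h := hG.free g v (congrArg Subtype.val h)
  strictMono g _ _ h := hG.strictMono g h

theorem isTree_restrict (hT : IsTree s t) (hA : IsConn s t A) :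
    IsTree (hG.src A) (hG.tgt A) where
  joined x y := by
    obtain ⟨_, h⟩ := ((hA x x.2 y y.2).iff_of_forall
      (R := fun z => ∃ hz : z ∈ A, Joined (hG.src A) (hG.tgt A) univ x ⟨z, hz⟩) (by
        rintro e he a b hab ⟨_, ha⟩
        rcases hab with ⟨rfl, rfl⟩ | ⟨rfl, rfl⟩
        · exact ⟨he.2, ha.trans ((joins_ends (⟨e, he⟩ : hG.edges A)).joined (mem_univ _))⟩
        · exact ⟨he.1, ha.trans
            ((joins_ends (⟨e, he⟩ : hG.edges A)).symm.joined (mem_univ _))⟩)).1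
      ⟨x.2, Joined.refl _⟩
    exact h
  exists_potential c := by
    classical
    -- Any extension of `c` would do; zero is used off the subtree.
    obtain ⟨p, hp⟩ := hT.exists_potential fun e => if h : e ∈ hG.edges A then c ⟨e, h⟩ else 0
    refine ⟨fun v => p v, fun e => ?_⟩
    have := hp e
    rwa [dif_pos e.2] at this

include hG in
/-- A finitely generated group acting freely on a tree has an invariant subtree with finitely many
orbits. -/
theorem exists_cofinite_subtree (hT : IsTree s t) [hne : Nonempty V] [hfg : Group.FG G] :
    ∃ A : SubMulAction G V, (A : Set V).Nonempty ∧ IsConn s t A ∧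
      Finite (orbitRel.Quotient G A) ∧ Finite (orbitRel.Quotient G (hG.edges A)) := by
  obtain ⟨v₀⟩ := hne
  obtain ⟨T, hT'⟩ := hfg.out
  choose D hDfin hD using fun g : G => (hT.joined v₀ (g • v₀)).exists_finite
  -- Finitely many edges contain paths from `v₀` to its translates by generators. The subtree is the
  -- component of `v₀` in the union of their translates.
  set P₀ : Set E := ⋃ g ∈ T, D g
  have hP₀ : P₀.Finite := T.finite_toSet.biUnion fun g _ => hDfin g
  set P : Set E := {e | ∃ g : G, g • e ∈ P₀}
  have hPsmul : ∀ (g : G), ∀ e ∈ P, g • e ∈ P := by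
    rintro g e ⟨h, he⟩
    exact ⟨h * g⁻¹, by simpa [mul_smul] using he⟩
  have hbase : ∀ g : G, Joined s t P v₀ (g • v₀) := by
    intro g
    have hg : g ∈ Subgroup.closure (T : Set G) := hT' ▸ Subgroup.mem_top g
    induction hg using Subgroup.closure_induction with
    | mem g hg =>
      refine (hD g).mono fun e he => ⟨1, ?_⟩
      rw [one_smul]
      exact mem_biUnion hg he
    | one => simpa using Joined.refl v₀
    | mul g h _ _ ihg ihh =>
      rw [mul_smul]
      exact ihg.trans (hG.joined_smul g (hPsmul g) ihh)
    | inv g _ ih =>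
      have := hG.joined_smul g⁻¹ (hPsmul g⁻¹) ih
      rw [inv_smul_smul] at this
      exact this.symm
  let A : SubMulAction G V :=
    { carrier := comp s t P v₀
      smul_mem' := fun g v hv => (hbase g).trans (hG.joined_smul g (hPsmul g) hv) }
  have hA : IsConn s t A := fun x hx y hy => by
    have hxy : Joined s t P x y := (Joined.symm hx).trans hy
    exact (hxy.restrict_comp (z := v₀) hx).mono fun e he => he.2
  have hedge : ∀ e ∈ hG.edges A, e ∈ P := fun e he =>
    hT.mem_of_joined ((Joined.symm he.1).trans he.2)
  refine ⟨A, ⟨v₀, Joined.refl v₀⟩, hA, ?_, ?_⟩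
  · refine finite_orbits_of_finite (D := Subtype.val ⁻¹' ({v₀} ∪ (s '' P₀ ∪ t '' P₀)))
      (((finite_singleton v₀).union ((hP₀.image s).union (hP₀.image t))).preimage
        Subtype.val_injective.injOn) ?_
    rintro ⟨x, hx⟩
    by_cases hxv : x = v₀
    · subst hxv
      exact ⟨1, Or.inl (by simp)⟩
    · obtain ⟨e, ⟨g, hg⟩, u, rfl, w, -, huw, -⟩ :=
        (Joined.symm hx).exists_exit (C := {x}) rfl (fun h => hxv (Eq.symm h))
      refine ⟨g, Or.inr ?_⟩
      rcases huw with ⟨h, -⟩ | ⟨-, h⟩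
      · exact Or.inl ⟨g • e, hg, by rw [hG.src_smul, h]; rfl⟩
      · exact Or.inr ⟨g • e, hg, by rw [hG.tgt_smul, h]; rfl⟩
  · refine finite_orbits_of_finite (D := Subtype.val ⁻¹' P₀)
      (hP₀.preimage Subtype.val_injective.injOn) ?_
    rintro ⟨e, he⟩
    exact hedge e he

end IsFreeAction

end Restrict

/-! ### Intersections of a subtree with translates of another -/

section Intersection

variable {F : Type*} [Group F] [MulAction F V] [MulAction F E]

theorem IsFreeAction.subgroup (hF : IsFreeAction F s t) (H : Subgroup F) : IsFreeAction H s t where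
  src_smul g e := hF.src_smul g e
  tgt_smul g e := hF.tgt_smul g e
  free g v h := Subtype.ext (hF.free g v h)
  strictMono g := hF.strictMono g

variable {H K : Subgroup F}

theorem mem_conj_smul_iff {g x : F} : x ∈ MulAut.conj g • K ↔ g⁻¹ * x * g ∈ K := by
  rw [Subgroup.mem_pointwise_smul_iff_inv_smul_mem]
  simp [MulAut.smul_def, ← map_inv]

/-- The intersection of an `H`-invariant set with the translate by `g` of a `K`-invariant set. -/
def interTranslate {Z : Type*} [MulAction F Z] (A : SubMulAction H Z) (B : SubMulAction K Z)
    (g : F) : SubMulAction ↥(H ⊓ MulAut.conj g • K) Z where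
  carrier := {x | x ∈ A ∧ g⁻¹ • x ∈ B}
  smul_mem' l x hx := by
    refine ⟨A.smul_mem ⟨l.1, l.2.1⟩ hx.1, ?_⟩
    have := B.smul_mem ⟨_, mem_conj_smul_iff.1 l.2.2⟩ hx.2
    change (g⁻¹ * l * g) • g⁻¹ • x ∈ B at this
    change g⁻¹ • l.1 • x ∈ B
    simpa [mul_smul] using this

theorem IsFreeAction.isConn_translate (hF : IsFreeAction F s t) {B : Set V} (hB : IsConn s t B)
    (g : F) : IsConn s t {x | g⁻¹ • x ∈ B} := by
  intro x hx y hy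
  have := hF.joined_smul g (Q := inducedEdges s t {x | g⁻¹ • x ∈ B}) (fun e he => ?_)
    (hB _ hx _ hy)
  · simpa using this
  · refine ⟨?_, ?_⟩
    · change g⁻¹ • s (g • e) ∈ B
      rw [hF.src_smul, inv_smul_smul]
      exact he.1
    · change g⁻¹ • t (g • e) ∈ B
      rw [hF.tgt_smul, inv_smul_smul]
      exact he.2

theorem IsFreeAction.isConn_interTranslate (hF : IsFreeAction F s t) (hT : IsTree s t)
    {A : SubMulAction H V} {B : SubMulAction K V} (hA : IsConn s t A) (hB : IsConn s t B) (g : F) :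
    IsConn s t (interTranslate A B g) :=
  hT.isConn_inter hA (hF.isConn_translate hB g)

/-- If the two subtrees were disjoint, an edge would separate them. A nontrivial element of the
intersection preserves both, so its powers give infinitely many such edges, while only finitely many
separate two given vertices. -/
theorem IsFreeAction.interTranslate_nonempty (hF : IsFreeAction F s t) (hT : IsTree s t)
    {A : SubMulAction H V} {B : SubMulAction K V} (hA : IsConn s t A) (hB : IsConn s t B)
    (hAne : (A : Set V).Nonempty) (hBne : (B : Set V).Nonempty) {g : F}
    (hg : H ⊓ MulAut.conj g • K ≠ ⊥) : (interTranslate A B g : Set V).Nonempty := by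
  by_contra hne
  have hBne' : {x | g⁻¹ • x ∈ (B : Set V)}.Nonempty := by
    obtain ⟨b, hb⟩ := hBne
    exact ⟨g • b, show g⁻¹ • g • b ∈ (B : Set V) by rwa [inv_smul_smul]⟩
  obtain ⟨e, he⟩ := hT.exists_separating hA (hF.isConn_translate hB g) hAne hBne'
    (disjoint_left.2 fun x hx hx' => hne ⟨x, hx, hx'⟩)
  obtain ⟨l, hl⟩ := Subgroup.ne_bot_iff_exists_ne_one.1 hg
  have hl1 : l.1 ≠ 1 := fun h => hl (Subtype.ext h)
  obtain ⟨x, hx⟩ := hAne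
  obtain ⟨y, hy⟩ := hBne'
  refine Set.infinite_of_injective_forall_mem (hF.injective_pow hl1 e) (fun n => ?_)
    (finite_separating (hT.joined x y))
  intro hj
  have hln : (l.1 ^ n)⁻¹ ∈ H ⊓ MulAut.conj g • K := inv_mem (pow_mem l.2 n)
  have hj' := hF.joined_smul (l.1 ^ n)⁻¹ (P := {l.1 ^ n • e}ᶜ) (Q := {e}ᶜ)
    (fun e' he' => fun h => he' (inv_smul_eq_iff.1 h)) hj
  refine he _ (A.smul_mem ⟨_, hln.1⟩ hx) _ ?_ hj'
  have := B.smul_mem ⟨_, mem_conj_smul_iff.1 hln.2⟩ hy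
  change (g⁻¹ * (l.1 ^ n)⁻¹ * g) • g⁻¹ • y ∈ B at this
  change g⁻¹ • (l.1 ^ n)⁻¹ • y ∈ B
  simpa [mul_smul] using this

end Intersection

end OrderedTree

/-! ### Counting orbits over double cosets -/

namespace OrderedTree

open Set MulAction

section Counting

variable {F Z : Type*} [Group F] [MulAction F Z] {H K : Subgroup F}

/-- The orbit of `z` under `H ∩ gKg⁻¹` determines the `H`-orbit of `z` and the `K`-orbit
of `g⁻¹ • z`. -/
noncomputable def orbitPair {P : SubMulAction H Z} {Q : SubMulAction K Z}
    {R : ∀ g : F, SubMulAction ↥(H ⊓ MulAut.conj g • K) Z}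
    (hR : ∀ g, ∀ z ∈ R g, z ∈ P ∧ g⁻¹ • z ∈ Q) (X : Set F)
    (x : Σ g : X, orbitRel.Quotient ↥(H ⊓ MulAut.conj (g : F) • K) (R g)) :
    orbitRel.Quotient H P × orbitRel.Quotient K Q :=
  (Quotient.mk _ ⟨x.2.out.1, (hR _ _ x.2.out.2).1⟩,
    Quotient.mk _ ⟨(x.1 : F)⁻¹ • x.2.out.1, (hR _ _ x.2.out.2).2⟩)

/-- If `a` in `H` and `k` in `K` witness equality of the two orbits, freeness gives `a = g * k *
g'⁻¹`. Then `g` and `g'` lie in one double coset, so they agree, and `a` lies in `H ∩ gKg⁻¹`. -/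
theorem injective_orbitPair (hfree : ∀ (g : F) (z : Z), g • z = z → g = 1)
    {P : SubMulAction H Z} {Q : SubMulAction K Z}
    {R : ∀ g : F, SubMulAction ↥(H ⊓ MulAut.conj g • K) Z}
    (hR : ∀ g, ∀ z ∈ R g, z ∈ P ∧ g⁻¹ • z ∈ Q) {X : Set F}
    (hX : InjOn (DoubleCoset.mk H K) X) : Function.Injective (orbitPair hR X) := by
  rintro ⟨⟨g, hg⟩, q⟩ ⟨⟨g', hg'⟩, q'⟩ h
  obtain ⟨a, ha⟩ : ∃ a : H, a.1 • q'.out.1 = q.out.1 := by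
    obtain ⟨a, ha⟩ := Quotient.exact (congrArg Prod.fst h)
    exact ⟨a, congrArg Subtype.val ha⟩
  obtain ⟨k, hk⟩ : ∃ k : K, k.1 • g'⁻¹ • q'.out.1 = g⁻¹ • q.out.1 := by
    obtain ⟨k, hk⟩ := Quotient.exact (congrArg Prod.snd h)
    exact ⟨k, congrArg Subtype.val hk⟩
  have hak : (a : F) = g * k * g'⁻¹ := by
    rw [← inv_mul_eq_one]
    refine hfree _ q'.out.1 ?_
    rw [mul_smul, inv_smul_eq_iff, ha, mul_smul, mul_smul, hk, smul_inv_smul]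
  obtain rfl : g = g' := by
    refine hX hg hg' ((DoubleCoset.eq H K g g').2 ⟨(a : F)⁻¹, inv_mem a.2, k, k.2, ?_⟩)
    rw [hak]
    group
  have hqq : q = q' := by
    rw [← q.out_eq, ← q'.out_eq]
    refine Quotient.sound ⟨⟨a, a.2, mem_conj_smul_iff.2 ?_⟩, Subtype.ext ha⟩
    rw [hak]
    simp [mul_assoc]
  rw [hqq]

end Counting

variable {V E : Type*} {s t : E → V} [LinearOrder E] {F : Type*} [Group F] [MulAction F V]
  [MulAction F E] {H K : Subgroup F}

namespace IsFreeAction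

variable (hF : IsFreeAction F s t)

theorem mem_edges_interTranslate {A : SubMulAction H V} {B : SubMulAction K V} (g : F) (e : E)
    (he : e ∈ (hF.subgroup (H ⊓ MulAut.conj g • K)).edges (interTranslate A B g)) :
    e ∈ (hF.subgroup H).edges A ∧ g⁻¹ • e ∈ (hF.subgroup K).edges B := by
  refine ⟨⟨he.1.1, he.2.1⟩, ?_, ?_⟩
  · rw [hF.src_smul]
    exact he.1.2
  · rw [hF.tgt_smul]
    exact he.2.2

/-- The orbits of bridges of the subtree spanned by an invariant set of vertices. -/
abbrev Bridges (H : Subgroup F) (A : SubMulAction H V) :=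
  BridgeOrbit H ((hF.subgroup H).src A) ((hF.subgroup H).tgt A)

theorem isBridge_left {A : SubMulAction H V} {B : SubMulAction K V} {g : F}
    (e : (hF.subgroup (H ⊓ MulAut.conj g • K)).edges (interTranslate A B g))
    (he : IsBridge ((hF.subgroup (H ⊓ MulAut.conj g • K)).src (interTranslate A B g))
      ((hF.subgroup (H ⊓ MulAut.conj g • K)).tgt (interTranslate A B g)) e) :
    IsBridge ((hF.subgroup H).src A) ((hF.subgroup H).tgt A)
      ⟨e, (hF.mem_edges_interTranslate g e e.2).1⟩ := by
  let f : interTranslate A B g → A := fun x => ⟨x, x.2.1⟩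
  let φ : (hF.subgroup (H ⊓ MulAut.conj g • K)).edges (interTranslate A B g) →
      (hF.subgroup H).edges A := fun e => ⟨e, (hF.mem_edges_interTranslate g e e.2).1⟩
  have hf : Function.Injective f := fun x y h =>
    Subtype.ext (congrArg (fun z : A => (z : V)) h)
  exact he.map f φ (fun _ => rfl) (fun _ => rfl) hf (fun _ _ h => h)

theorem isBridge_right {A : SubMulAction H V} {B : SubMulAction K V} {g : F}
    (e : (hF.subgroup (H ⊓ MulAut.conj g • K)).edges (interTranslate A B g))
    (he : IsBridge ((hF.subgroup (H ⊓ MulAut.conj g • K)).src (interTranslate A B g))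
      ((hF.subgroup (H ⊓ MulAut.conj g • K)).tgt (interTranslate A B g)) e) :
    IsBridge ((hF.subgroup K).src B) ((hF.subgroup K).tgt B)
      ⟨g⁻¹ • e.1, (hF.mem_edges_interTranslate g e e.2).2⟩ := by
  let f : interTranslate A B g → B := fun x => ⟨g⁻¹ • x.1, x.2.2⟩
  let φ : (hF.subgroup (H ⊓ MulAut.conj g • K)).edges (interTranslate A B g) →
      (hF.subgroup K).edges B := fun e => ⟨g⁻¹ • e.1, (hF.mem_edges_interTranslate g e e.2).2⟩
  have hf : Function.Injective f := fun x y h =>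
    Subtype.ext (MulAction.injective g⁻¹ (congrArg (fun z : B => (z : V)) h))
  have hs : ∀ e, (hF.subgroup K).src B (φ e) =
      f ((hF.subgroup (H ⊓ MulAut.conj g • K)).src (interTranslate A B g) e) := fun e =>
    Subtype.ext (hF.src_smul g⁻¹ e.1)
  have ht : ∀ e, (hF.subgroup K).tgt B (φ e) =
      f ((hF.subgroup (H ⊓ MulAut.conj g • K)).tgt (interTranslate A B g) e) := fun e =>
    Subtype.ext (hF.tgt_smul g⁻¹ e.1)
  exact he.map f φ hs ht hf (fun _ _ h => hF.strictMono g⁻¹ h)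

/-- Each pair of orbits of bridges comes from at most one orbit of bridges of the intersections. -/
theorem sum_card_bridges_le (A : SubMulAction H V) (B : SubMulAction K V)
    [Finite (orbitRel.Quotient H ((hF.subgroup H).edges A))]
    [Finite (orbitRel.Quotient K ((hF.subgroup K).edges B))]
    {Y : Finset F} (hY : InjOn (DoubleCoset.mk H K) Y) :
    ∑ g ∈ Y, Nat.card (hF.Bridges _ (interTranslate A B g)) ≤
      Nat.card (hF.Bridges H A) * Nat.card (hF.Bridges K B) := by
  have hinj := injective_orbitPair hF.free_edge
    (fun g => hF.mem_edges_interTranslate (A := A) (B := B) g) hY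
  let Ψ : (Σ g : Y, hF.Bridges _ (interTranslate A B (g : F))) →
      hF.Bridges H A × hF.Bridges K B := fun x =>
    (⟨(orbitPair (fun g => hF.mem_edges_interTranslate (A := A) (B := B) g) Y ⟨x.1, x.2.1⟩).1,
      (hF.subgroup H).restrict.isBridge_out_mk.2 (hF.isBridge_left _ x.2.2)⟩,
     ⟨(orbitPair (fun g => hF.mem_edges_interTranslate (A := A) (B := B) g) Y ⟨x.1, x.2.1⟩).2,
      (hF.subgroup K).restrict.isBridge_out_mk.2 (hF.isBridge_right _ x.2.2)⟩)
  have hΨ : Function.Injective Ψ := by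
    rintro ⟨g, q⟩ ⟨g', q'⟩ h
    have := hinj (a₁ := ⟨g, q.1⟩) (a₂ := ⟨g', q'.1⟩)
      (Prod.ext (congrArg (fun z => z.1.1) h) (congrArg (fun z => z.2.1) h))
    obtain ⟨q, hq⟩ := q
    obtain ⟨q', hq'⟩ := q'
    cases this
    rfl
  -- Finiteness of the fibres is needed for the cardinality of the sigma type to be the sum; it
  -- comes from the injection itself.
  have hfin : ∀ g : Y, Finite (hF.Bridges _ (interTranslate A B (g : F))) := fun g =>
    Finite.of_injective (fun q => Ψ ⟨g, q⟩) (hΨ.comp sigma_mk_injective)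
  rw [← Nat.card_prod, ← Finset.sum_coe_sort, ← Nat.card_sigma]
  exact Nat.card_le_card_of_injective Ψ hΨ

include hF in
-- Each such `g` contributes at least one orbit, and all these orbits inject into a finite product.
theorem finite_interTranslate_nonempty (A : SubMulAction H V) (B : SubMulAction K V)
    [Finite (orbitRel.Quotient H A)] [Finite (orbitRel.Quotient K B)]
    {X : Set F} (hX : InjOn (DoubleCoset.mk H K) X) :
    {g ∈ X | (interTranslate A B g : Set V).Nonempty}.Finite := by
  set Y := {g ∈ X | (interTranslate A B g : Set V).Nonempty}
  have hinj := injective_orbitPair hF.free (R := interTranslate A B) (fun g _ h => h)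
    (hX.mono (sep_subset _ _ : Y ⊆ X))
  have : Finite Y := Finite.of_injective
    (fun g : Y => orbitPair (R := interTranslate A B) (fun g _ h => h) Y
      ⟨g, Quotient.mk _ ⟨g.2.2.some, g.2.2.some_mem⟩⟩)
    fun g g' h => congrArg Sigma.fst (hinj h)
  exact Set.toFinite Y

include hF in
theorem finite_orbits_interTranslate (A : SubMulAction H V) (B : SubMulAction K V)
    [Finite (orbitRel.Quotient H A)] [Finite (orbitRel.Quotient K B)] (g : F) :
    Finite (orbitRel.Quotient ↥(H ⊓ MulAut.conj g • K) (interTranslate A B g)) :=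
  Finite.of_injective
    (fun q => orbitPair (R := interTranslate A B) (fun _ _ h => h) {g} ⟨⟨g, rfl⟩, q⟩)
    ((injective_orbitPair hF.free _ (injOn_singleton _ _)).comp sigma_mk_injective)

theorem finite_orbits_edges_interTranslate (A : SubMulAction H V) (B : SubMulAction K V)
    [Finite (orbitRel.Quotient H ((hF.subgroup H).edges A))]
    [Finite (orbitRel.Quotient K ((hF.subgroup K).edges B))] (g : F) :
    Finite (orbitRel.Quotient ↥(H ⊓ MulAut.conj g • K)
      ((hF.subgroup (H ⊓ MulAut.conj g • K)).edges (interTranslate A B g))) :=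
  Finite.of_injective
    (fun q => orbitPair (fun g => hF.mem_edges_interTranslate (A := A) (B := B) g) {g}
      ⟨⟨g, rfl⟩, q⟩)
    ((injective_orbitPair hF.free_edge _ (injOn_singleton _ _)).comp sigma_mk_injective)

end IsFreeAction

/-- The strengthened Hanna Neumann inequality, in terms of homomorphisms to `ℚ`. -/
theorem IsFreeAction.hanna_neumann (hF : IsFreeAction F s t) (hT : IsTree s t) [Nonempty V]
    [Group.FG H] [Group.FG K] (hH : H ≠ ⊥) (hK : K ≠ ⊥) :
    (∀ g : F, Module.Finite ℚ (Additive ↥(H ⊓ MulAut.conj g • K) →+ ℚ)) ∧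
    (∀ X : Set F, InjOn (DoubleCoset.mk H K) X →
      {g ∈ X | H ⊓ MulAut.conj g • K ≠ ⊥}.Finite) ∧
    ∀ Y : Finset F, InjOn (DoubleCoset.mk H K) Y →
      (∀ g ∈ Y, H ⊓ MulAut.conj g • K ≠ ⊥) →
      ∑ g ∈ Y, ((Module.finrank ℚ (Additive ↥(H ⊓ MulAut.conj g • K) →+ ℚ) : ℤ) - 1) ≤
        ((Module.finrank ℚ (Additive H →+ ℚ) : ℤ) - 1) *
          ((Module.finrank ℚ (Additive K →+ ℚ) : ℤ) - 1) := by
  obtain ⟨A, hAne, hA, hAV, hAE⟩ := (hF.subgroup H).exists_cofinite_subtree hT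
  obtain ⟨B, hBne, hB, hBV, hBE⟩ := (hF.subgroup K).exists_cofinite_subtree hT
  have hrank : ∀ (L : Subgroup F) (C : SubMulAction L V), L ≠ ⊥ → (C : Set V).Nonempty →
      IsConn s t C → Finite (orbitRel.Quotient L C) →
      Finite (orbitRel.Quotient L ((hF.subgroup L).edges C)) →
      Module.Finite ℚ (Additive L →+ ℚ) ∧
      Module.finrank ℚ (Additive L →+ ℚ) = Nat.card (hF.Bridges L C) + 1 := by
    intro L C hL hne hC _ _
    have : Nonempty C := hne.to_subtype
    exact ⟨((hF.subgroup L).restrict.finrank_hom_add_card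
        ((hF.subgroup L).isTree_restrict hT hC)).1,
      (hF.subgroup L).restrict.finrank_hom ((hF.subgroup L).isTree_restrict hT hC)
        (Subgroup.ne_bot_iff_exists_ne_one.1 hL)⟩
  have hinter : ∀ g, H ⊓ MulAut.conj g • K ≠ ⊥ → _ := fun g hg =>
    hrank (H ⊓ MulAut.conj g • K) (interTranslate A B g) hg
      (hF.interTranslate_nonempty hT hA hB hAne hBne hg) (hF.isConn_interTranslate hT hA hB g)
      (hF.finite_orbits_interTranslate A B g) (hF.finite_orbits_edges_interTranslate A B g)
  refine ⟨fun g => ?_, fun X hX => ?_, fun Y hY hYne => ?_⟩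
  -- For a trivial intersection the two subtrees may be disjoint, so this case avoids the tree.
  · by_cases hg : H ⊓ MulAut.conj g • K = ⊥
    · have : Subsingleton ↥(H ⊓ MulAut.conj g • K) := by
        rw [hg]
        infer_instance
      have : Subsingleton (Additive ↥(H ⊓ MulAut.conj g • K) →+ ℚ) := ⟨fun φ ψ =>
        AddMonoidHom.ext fun x => by
          rw [Subsingleton.elim (α := ↥(H ⊓ MulAut.conj g • K)) x 1]
          exact (map_zero φ).trans (map_zero ψ).symm⟩
      infer_instance
    · exact (hinter g hg).1
  · exact (hF.finite_interTranslate_nonempty A B hX).subset fun g hg =>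
      ⟨hg.1, hF.interTranslate_nonempty hT hA hB hAne hBne hg.2⟩
  · rw [(hrank H A hH hAne hA hAV hAE).2, (hrank K B hK hBne hB hBV hBE).2,
      Finset.sum_congr rfl fun g hg => by rw [(hinter g (hYne g hg)).2]]
    push_cast
    simp only [add_sub_cancel_right]
    exact_mod_cast hF.sum_card_bridges_le A B hY

end OrderedTree

/-! ### A left-invariant order on free groups -/

namespace FreeGroup

variable {S : Type*} [LinearOrder S]

/-- The sign of the comparison of `a` with `b`. -/
def cmpSign {α : Type*} [LinearOrder α] (a b : α) : ℤ :=
  if a < b then 1 else if b < a then -1 else 0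

theorem abs_cmpSign_le {α : Type*} [LinearOrder α] (a b : α) : |cmpSign a b| ≤ 1 := by
  unfold cmpSign
  split_ifs <;> simp

theorem cmpSign_swap {α : Type*} [LinearOrder α] (a b : α) : cmpSign b a = -cmpSign a b := by
  unfold cmpSign
  rcases lt_trichotomy a b with h | rfl | h
  · simp [h, h.not_gt]
  · simp
  · simp [h, h.not_gt]

theorem odd_cmpSign {α : Type*} [LinearOrder α] {a b : α} (h : a ≠ b) : Odd (cmpSign a b) := by
  unfold cmpSign
  rcases lt_or_gt_of_ne h with h | h
  · simp [h]
  · simp [h, h.not_gt]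

theorem abs_cmpSign_sub_sub_le {α : Type*} [LinearOrder α] (a b c : α) :
    |cmpSign a c - cmpSign a b - cmpSign b c| ≤ 1 := by
  unfold cmpSign
  split_ifs <;> first | (exfalso; order) | simp

/-- The contribution of the turn between two consecutive letters of a word. -/
def turn (x y : S × Bool) : ℤ := cmpSign (toLex (x.1, !x.2)) (toLex y)

/-- The contribution of the turn at the place where two words are joined. -/
def junction (u v : List (S × Bool)) : ℤ :=
  match u.getLast?, v.head? with
  | some x, some y => turn x y
  | _, _ => 0

/-- The weight of a word: the signs of its letters and of its turns are added up. -/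
def weight : List (S × Bool) → ℤ
  | [] => 0
  | x :: l => (if x.2 then 1 else -1) + junction [x] l + weight l

@[simp] theorem junction_nil_left (v : List (S × Bool)) : junction [] v = 0 := rfl

@[simp] theorem junction_nil_right (u : List (S × Bool)) : junction u [] = 0 := by
  unfold junction
  split <;> simp_all

@[simp] theorem junction_concat_cons (u v : List (S × Bool)) (x y : S × Bool) :
    junction (u ++ [x]) (y :: v) = turn x y := by
  simp [junction]

@[simp] theorem junction_singleton_cons (v : List (S × Bool)) (x y : S × Bool) :
    junction [x] (y :: v) = turn x y := rfl

theorem abs_junction_le (u v : List (S × Bool)) : |junction u v| ≤ 1 := by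
  unfold junction
  split
  · exact abs_cmpSign_le _ _
  · simp

theorem weight_append (u v : List (S × Bool)) :
    weight (u ++ v) = weight u + weight v + junction u v := by
  induction u with
  | nil => simp [weight]
  | cons x u ih =>
    rw [List.cons_append, weight, ih, weight]
    rcases u with _ | ⟨y, u⟩
    · simp [weight]
      ring
    · have : junction (x :: y :: u) v = junction (y :: u) v := by simp [junction]
      rw [this, List.cons_append, junction_singleton_cons, junction_singleton_cons]
      ring

omit [LinearOrder S] in
theorem invRev_cons_eq (x : S × Bool) (l : List (S × Bool)) :
    invRev (x :: l) = invRev l ++ [(x.1, !x.2)] := by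
  simp [invRev]

/-- Inversion flips the sign of each letter and exchanges the two directions compared at each turn.
-/
theorem weight_invRev (u : List (S × Bool)) : weight (invRev u) = -weight u := by
  induction u with
  | nil => simp [weight, invRev]
  | cons x u ih =>
    have h1 : weight [((x.1, !x.2) : S × Bool)] = -(if x.2 then 1 else -1) := by
      rcases x with ⟨a, _ | _⟩ <;> simp [weight]
    have h2 : junction (invRev u) [(x.1, !x.2)] = -junction [x] u := by
      rcases u with _ | ⟨y, u⟩
      · simp [invRev]
      · rw [invRev_cons_eq, junction_concat_cons, junction_singleton_cons, turn, turn,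
          ← cmpSign_swap]
        simp
    rw [invRev_cons_eq, weight_append, ih, h1, h2, weight]
    ring

/-- A reduced word with n letters has n - 1 turns, none zero, so the weight is a sum of 2n - 1
signs. -/
theorem odd_weight {u : List (S × Bool)} (hu : IsReduced u) (hne : u ≠ []) : Odd (weight u) := by
  induction u with
  | nil => exact absurd rfl hne
  | cons x u ih =>
    have hx : Odd (if x.2 then 1 else -1 : ℤ) := by split_ifs <;> simp
    rcases u with _ | ⟨y, u⟩
    · simpa [weight] using hx
    · rw [isReduced_cons_cons] at hu
      have hturn : Odd (turn x y) := odd_cmpSign fun h => by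
        have h' : ((x.1, !x.2) : S × Bool) = y := toLex.injective h
        have hx1 : ((x.1, !x.2) : S × Bool).1 = y.1 := by rw [h']
        have := hu.1 hx1
        rw [← h'] at this
        simp at this
      rw [weight, junction_singleton_cons]
      exact (hx.add_odd hturn).add_odd (ih hu.2 (by simp))

theorem exists_cancellation {u v : List (S × Bool)} (hu : IsReduced u) (hv : IsReduced v) :
    ∃ a b c, u = a ++ c ∧ v = invRev c ++ b ∧ IsReduced (a ++ b) := by
  induction u using List.reverseRecOn generalizing v with
  | nil => exact ⟨[], v, [], by simp, by simp [invRev], by simpa using hv⟩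
  | append_singleton u x ih =>
    rcases v with _ | ⟨y, v⟩
    · exact ⟨u ++ [x], [], [], by simp, by simp [invRev], by simpa using hu⟩
    by_cases hxy : y = (x.1, !x.2)
    · obtain ⟨a, b, c, rfl, rfl, hab⟩ := ih (hu.infix (List.prefix_append _ _).isInfix)
        (hv.infix (List.suffix_cons _ _).isInfix)
      refine ⟨a, b, c ++ [x], by simp, ?_, hab⟩
      subst hxy
      simp [invRev]
    · refine ⟨u ++ [x], y :: v, [], by simp, by simp [invRev], ?_⟩
      refine List.isChain_append.2 ⟨hu, hv, ?_⟩
      intro a ha b hb hab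
      simp only [List.getLast?_append, List.getLast?_singleton, Option.some_or, Option.mem_def,
        Option.some.injEq, List.head?_cons] at ha hb
      subst ha hb
      by_contra hne
      refine hxy (Prod.ext hab.symm ?_)
      revert hne
      cases x.2 <;> cases y.2 <;> simp

/-- After the cancelled part `c` is split off, its weight drops out. What remains are the turns
among the three directions at the branch point, and `abs_cmpSign_sub_sub_le` bounds their
combination by one. -/
theorem abs_weight_mul_le (x y : FreeGroup S) :
    |weight (x * y).toWord - weight x.toWord - weight y.toWord| ≤ 1 := by
  obtain ⟨a, b, c, hx, hy, hab⟩ := exists_cancellation (isReduced_toWord (x := x))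
    (isReduced_toWord (x := y))
  have hxy : (x * y).toWord = a ++ b := by
    have : x * y = mk (a ++ b) := by
      rw [← mk_toWord (x := x), ← mk_toWord (x := y), hx, hy, ← mul_mk, ← mul_mk, ← mul_mk,
        ← inv_mk]
      group
    rw [this, toWord_mk, hab.reduce_eq]
  rw [hxy, hx, hy, weight_append, weight_append, weight_append, weight_invRev]
  have : weight a + weight b + junction a b - (weight a + weight c + junction a c) -
      (-weight c + weight b + junction (invRev c) b) =
      junction a b - junction a c - junction (invRev c) b := by ring
  rw [this]
  rcases c with _ | ⟨z, c⟩
  · simpa [invRev] using abs_junction_le a b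
  rcases List.eq_nil_or_concat a with rfl | ⟨a, w, rfl⟩
  · simpa using abs_junction_le (invRev (z :: c)) b
  rcases b with _ | ⟨w', b⟩
  · simpa using abs_junction_le (a ++ [w]) (z :: c)
  rw [invRev_cons_eq, List.concat_eq_append, junction_concat_cons, junction_concat_cons,
    junction_concat_cons]
  simpa [turn] using abs_cmpSign_sub_sub_le (toLex (w.1, !w.2)) (toLex z) (toLex w')

omit [LinearOrder S] in
/-- Free groups are left-orderable. -/
theorem exists_linearOrder : ∃ _ : LinearOrder (FreeGroup S),
    ∀ g x y : FreeGroup S, x < y → g * x < g * y := by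
  classical
  let _ : LinearOrder S := linearOrderOfSTO WellOrderingRel
  -- Positive elements are those of positive weight. Transitivity holds since the defect is at most
  -- one and 1 + 1 - 1 > 0; totality holds since a nontrivial element has odd, hence nonzero,
  -- weight.
  let r : FreeGroup S → FreeGroup S → Prop := fun x y => 0 < weight (x⁻¹ * y).toWord
  have : IsStrictTotalOrder (FreeGroup S) r :=
    { irrefl := fun x h => by simp [r, weight] at h
      trans := fun x y z h h' => by
        have := abs_le.1 (abs_weight_mul_le (x⁻¹ * y) (y⁻¹ * z))
        rw [show x⁻¹ * y * (y⁻¹ * z) = x⁻¹ * z by group] at this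
        simp only [r] at h h' ⊢
        omega
      trichotomous := fun x y h h' => by
        by_contra hne
        have h1 : (x⁻¹ * y).toWord ≠ [] := fun h => hne (inv_mul_eq_one.1 (toWord_eq_nil_iff.1 h))
        have h2 := odd_weight isReduced_toWord h1
        have h3 : weight (y⁻¹ * x).toWord = -weight (x⁻¹ * y).toWord := by
          rw [← weight_invRev, ← toWord_inv]
          simp
        simp only [r] at h h'
        rw [h3] at h'
        have h4 : weight (x⁻¹ * y).toWord = 0 := by omega
        rw [h4] at h2
        simp at h2 }
  refine ⟨linearOrderOfSTO r, fun g x y h => ?_⟩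
  change r (g * x) (g * y)
  have h : r x y := h
  simp only [r] at h ⊢
  rwa [show (g * x)⁻¹ * (g * y) = x⁻¹ * y by group]

end FreeGroup

open OrderedTree

/-! ### The Cayley tree and its invariant order -/

/-- The edges of the Cayley graph of `F` with respect to a family of elements indexed by `S`: the
edge `(g, x)` goes from `g` to the product of `g` and the element indexed by `x`. -/
def CayleyEdge (F S : Type*) := F × S

namespace CayleyEdge

variable {F S : Type*} [Group F]

instance : MulAction F (CayleyEdge F S) where
  smul g e := (g * e.1, e.2)
  one_smul e := Prod.ext (one_mul e.1) rfl
  mul_smul g h e := Prod.ext (mul_assoc g h e.1) rfl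

theorem isTree (b : FreeGroupBasis S F) :
    IsTree (fun e : CayleyEdge F S => e.1) (fun e => e.1 * b e.2) where
  joined := by
    have h1 : ∀ x g : F, OrderedTree.Joined (fun e : CayleyEdge F S => e.1) (fun e => e.1 * b e.2) Set.univ
        x (x * g) := by
      intro x g
      have hg : g ∈ Subgroup.closure (Set.range b) := b.closure_range ▸ Subgroup.mem_top g
      induction hg using Subgroup.closure_induction generalizing x with
      | mem g hg =>
        obtain ⟨i, rfl⟩ := hg
        exact (joins_ends (s := fun e : CayleyEdge F S => e.1) (t := fun e => e.1 * b e.2)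
          ((x, i) : CayleyEdge F S)).joined (Set.mem_univ _)
      | one =>
        rw [mul_one]
        exact OrderedTree.Joined.refl x
      | mul g h _ _ ihg ihh =>
        rw [← mul_assoc]
        exact (ihg x).trans (ihh (x * g))
      | inv g _ ih => simpa using (ih (x * g⁻¹)).symm
    intro x y
    simpa using h1 x (x⁻¹ * y)
  exists_potential c := by
    -- Each basis element crosses an edge and adds its value of `c`. Freeness extends this to a
    -- right action of `F`, hence the opposite group, and the potential at `g` is the total
    -- accumulated from `(1, 0)`.
    let σ : S → (Equiv.Perm (F × ℚ))ᵐᵒᵖ := fun i => MulOpposite.op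
      { toFun := fun p => (p.1 * b i, p.2 + c (p.1, i))
        invFun := fun p => (p.1 * (b i)⁻¹, p.2 - c (p.1 * (b i)⁻¹, i))
        left_inv := fun p => by simp
        right_inv := fun p => by simp }
    let Φ := b.lift σ
    have hΦ : ∀ i, Φ (b i) = σ i := fun i => congrFun (b.lift.symm_apply_apply σ) i
    have hfst : ∀ g : F, ∀ p, ((Φ g).unop p).1 = p.1 * g := by
      intro g
      have hg : g ∈ Subgroup.closure (Set.range b) := b.closure_range ▸ Subgroup.mem_top g
      induction hg using Subgroup.closure_induction with
      | mem g hg =>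
        obtain ⟨i, rfl⟩ := hg
        intro p
        rw [hΦ]
        rfl
      | one => simp
      | mul g h _ _ ihg ihh =>
        intro p
        rw [map_mul, MulOpposite.unop_mul, Equiv.Perm.mul_apply, ihh, ihg, mul_assoc]
      | inv g _ ih =>
        intro p
        have := ih ((Φ g⁻¹).unop p)
        rw [map_inv, MulOpposite.unop_inv, ← Equiv.Perm.mul_apply, mul_inv_cancel,
          Equiv.Perm.one_apply] at this
        rw [eq_mul_inv_iff_mul_eq, this, map_inv, MulOpposite.unop_inv]
    refine ⟨fun g => ((Φ g).unop (1, 0)).2, fun e => ?_⟩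
    change ((Φ (e.1 * b e.2)).unop (1, 0)).2 = _
    rw [map_mul, MulOpposite.unop_mul, Equiv.Perm.mul_apply, hΦ]
    change ((Φ e.1).unop (1, 0)).2 + c (((Φ e.1).unop (1, 0)).1, e.2) = _
    rw [hfst, one_mul]
    rfl

/-- Edges are compared by source in the left-invariant order, then by label, which translation
leaves unchanged. -/
theorem exists_linearOrder (b : FreeGroupBasis S F) : ∃ _ : LinearOrder (CayleyEdge F S),
    IsFreeAction F (fun e : CayleyEdge F S => e.1) (fun e => e.1 * b e.2) := by
  classical
  let _ : LinearOrder S := linearOrderOfSTO WellOrderingRel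
  obtain ⟨_, hlt⟩ := FreeGroup.exists_linearOrder (S := S)
  let κ : CayleyEdge F S → FreeGroup S ×ₗ S := fun e => toLex (b.repr e.1, e.2)
  have hκ : Function.Injective κ := fun e e' h => by
    have h' : (b.repr e.1, e.2) = (b.repr e'.1, e'.2) := toLex.injective h
    exact Prod.ext (b.repr.injective (Prod.ext_iff.1 h').1) (Prod.ext_iff.1 h').2
  let o : LinearOrder (CayleyEdge F S) := LinearOrder.lift' κ hκ
  refine ⟨o, fun _ _ => rfl, fun _ _ => mul_assoc _ _ _, fun g v h => ?_,
    fun g e e' h => ?_⟩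
  · exact mul_eq_right.1 h
  · have h : κ e < κ e' := h
    change κ (g • e) < κ (g • e')
    have hsmul : ∀ e, κ (g • e) = toLex (b.repr g * b.repr e.1, e.2) := fun e => by
      rw [← map_mul]
      rfl
    rw [hsmul, hsmul, Prod.Lex.toLex_lt_toLex]
    rcases Prod.Lex.toLex_lt_toLex.1 h with h | ⟨h, h'⟩
    · exact Or.inl (hlt _ _ _ h)
    · exact Or.inr ⟨congrArg (b.repr g * ·) h, h'⟩

end CayleyEdge

/-! ### The inequalities for ranks -/

/-- The strengthened Hanna Neumann inequality. -/
theorem IsFreeGroup.hanna_neumann {F : Type*} [Group F] [IsFreeGroup F] (H K : Subgroup F)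
    [Group.FG H] [Group.FG K] (hH : H ≠ ⊥) (hK : K ≠ ⊥) :
    ∃ _ : ∀ g : F, Group.FG ↥(H ⊓ MulAut.conj g • K),
      (∀ X : Set F, Set.InjOn (DoubleCoset.mk H K) X →
        {g ∈ X | H ⊓ MulAut.conj g • K ≠ ⊥}.Finite) ∧
      ∀ Y : Finset F, Set.InjOn (DoubleCoset.mk H K) Y →
        (∀ g ∈ Y, H ⊓ MulAut.conj g • K ≠ ⊥) →
        ∑ g ∈ Y, ((Group.rank ↥(H ⊓ MulAut.conj g • K) : ℤ) - 1) ≤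
          ((Group.rank H : ℤ) - 1) * ((Group.rank K : ℤ) - 1) := by
  obtain ⟨_, hF⟩ := CayleyEdge.exists_linearOrder (IsFreeGroup.basis F)
  have hT := CayleyEdge.isTree (IsFreeGroup.basis F)
  obtain ⟨hfin, hX, hY⟩ := hF.hanna_neumann hT hH hK
  -- The intersections are free by Nielsen–Schreier, so finite-dimensionality of Hom to ℚ gives
  -- finite generation.
  have hfg : ∀ g : F, Group.FG ↥(H ⊓ MulAut.conj g • K) := fun g =>
    have := hfin g
    IsFreeGroup.fg_and_rank_eq.1
  refine ⟨hfg, hX, fun Y hYinj hYne => ?_⟩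
  rw [Finset.sum_congr rfl fun g _ => by rw [IsFreeGroup.rank_eq], IsFreeGroup.rank_eq,
    IsFreeGroup.rank_eq]
  exact hY Y hYinj hYne

theorem mainTheorem4 {F : Type*} [Group F] [IsFreeGroup F] (H K : Subgroup F)
    [Group.FG ↥H] [Group.FG ↥K] (hH : H ≠ ⊥) (hK : K ≠ ⊥) :
    (∃ _ : Group.FG ↥(H ⊓ K),
      (Group.rank ↥(H ⊓ K) : ℤ) - 1 ≤
        2 * ((Group.rank ↥H : ℤ) - 1) * ((Group.rank ↥K : ℤ) - 1)
          - min ((Group.rank ↥H : ℤ) - 1) ((Group.rank ↥K : ℤ) - 1)) ∧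
    (∃ _ : ∀ g : F, Group.FG ↥(H ⊓ MulAut.conj g • K),
      ∀ X : Set F, Set.BijOn (DoubleCoset.mk H K) X Set.univ →
        ∃ hY : {g ∈ X | H ⊓ MulAut.conj g • K ≠ ⊥}.Finite,
          ∑ g ∈ hY.toFinset, ((Group.rank ↥(H ⊓ MulAut.conj g • K) : ℤ) - 1) ≤
            2 * ((Group.rank ↥H : ℤ) - 1) * ((Group.rank ↥K : ℤ) - 1)
              - min ((Group.rank ↥H : ℤ) - 1) ((Group.rank ↥K : ℤ) - 1)) := by
  have rank_pos : ∀ (L : Subgroup F) [Group.FG L], L ≠ ⊥ → 1 ≤ (Group.rank L : ℤ) := by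
    intro L _ hL
    rw [← Nat.cast_one, Nat.cast_le, Nat.one_le_iff_ne_zero]
    intro h0
    obtain ⟨T, hT, hT'⟩ := Group.rank_spec L
    rw [h0, Finset.card_eq_zero] at hT
    rw [hT, Finset.coe_empty, Subgroup.closure_empty] at hT'
    refine hL ((Subgroup.eq_bot_iff_forall L).2 fun x hx => ?_)
    have hx' : (⟨x, hx⟩ : L) ∈ (⊥ : Subgroup L) := hT' ▸ Subgroup.mem_top _
    exact congrArg Subtype.val (Subgroup.mem_bot.1 hx')
  have bound : ((Group.rank ↥H : ℤ) - 1) * ((Group.rank ↥K : ℤ) - 1) ≤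
      2 * ((Group.rank ↥H : ℤ) - 1) * ((Group.rank ↥K : ℤ) - 1)
        - min ((Group.rank ↥H : ℤ) - 1) ((Group.rank ↥K : ℤ) - 1) := by
    have hh := sub_nonneg.2 (rank_pos H hH)
    have hk := sub_nonneg.2 (rank_pos K hK)
    generalize (Group.rank ↥H : ℤ) - 1 = a at hh ⊢
    generalize (Group.rank ↥K : ℤ) - 1 = b at hk ⊢
    -- For `a = 0` both sides vanish; for `a ≥ 1`, `a * b ≥ b ≥ min a b`.
    rcases hh.eq_or_lt with rfl | hh
    · simp [hk]
    · nlinarith [min_le_right a b]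
  obtain ⟨hfg, hfin, hsum⟩ := IsFreeGroup.hanna_neumann H K hH hK
  refine ⟨?_, hfg, fun X hX => ⟨hfin X hX.injOn, ?_⟩⟩
  · have h1 : H ⊓ MulAut.conj (1 : F) • K = H ⊓ K := by simp
    have hle : (Group.rank ↥(H ⊓ MulAut.conj (1 : F) • K) : ℤ) - 1 ≤
        ((Group.rank ↥H : ℤ) - 1) * ((Group.rank ↥K : ℤ) - 1) := by
      -- The sum bound covers only nontrivial intersections; for a trivial one the left side is -1.
      by_cases hne : H ⊓ MulAut.conj (1 : F) • K = ⊥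
      · have hr : Group.rank ↥(H ⊓ MulAut.conj (1 : F) • K) = 0 := by
          rw [Group.rank_congr (MulEquiv.subgroupCongr hne)]
          exact Nat.le_zero.1 (Group.rank_le (S := ∅) (Subsingleton.elim _ _))
        rw [hr]
        have := mul_nonneg (sub_nonneg.2 (rank_pos H hH)) (sub_nonneg.2 (rank_pos K hK))
        push_cast
        linarith
      · simpa using hsum {1} (by simp) (by simpa using hne)
    -- The rank depends on a proof of finite generation, which must be generalized before the
    -- subgroup is rewritten.
    revert hle
    generalize_proofs hfg1
    revert hfg1
    rw [h1]
    exact fun hfg1 hle => ⟨hfg1, hle.trans bound⟩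
  · refine (hsum _ (hX.injOn.mono fun g hg => ?_) fun g hg => ?_).trans bound
    · exact ((hfin X hX.injOn).mem_toFinset.1 hg).1
    · exact ((hfin X hX.injOn).mem_toFinset.1 hg).2
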